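/- **Weak infinite time register machines.** A program is a finite list of instructions, in lines numbered $0,\dots,s-1$, of the forms $R_i:=0$; $R_i:=R_i+1$; $R_j:=R_i$; "if $\varphi$, go to line $l$", where $\varphi$ is a Boolean combination of statements $R_i=R_j$. Let $\alpha$ be an ordinal. In an $\alpha$-wITRM-computation every register contains an ordinal $<\alpha$. Time runs through the ordinals. At successor times the instruction in the active program line is carried out as usual. At limit times the active program line and the content of each register are the inferior limits of the earlier active lines and of the earlier contents of that register; if one of the latter is not $<\alpha$, the computation crashes (it is undefined). The program stops when the active line is not one of the lines $0,\dots,s-1$. Let $P(\zeta)$ (respectively $P(\iota,\xi)$) denote the computation of $P$ starting in line $0$ with $\zeta$ in the first register (respectively $\iota,\xi$ in the first two registers) and $0$ in all others. - An ordinal $\gamma$ is *$\alpha$-wITRM-clockable* if there are a program $P$ and $\zeta<\alpha$ such that the $\alpha$-wITRM-computation $P(\zeta)$ halts in exactly $\gamma$ many steps. - $\alpha$ is *$u$-weak* if every $\alpha$-wITRM-clockable ordinal is $<\alpha$. - $\alpha$ is *wITRM-singular* if there are $\beta<\alpha$, a function $f:\beta\to\alpha$ whose range is cofinal in $\alpha$,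 a program $P$ and $\xi<\alpha$ such that, for every $\iota<\beta$, the $\alpha$-wITRM-computation $P(\iota,\xi)$ halts with $f(\iota)$ in the first register. Otherwise $\alpha$ is *wITRM-regular*. - $\alpha$ is *admissible* if the level $L_\alpha$ of the constructible hierarchy is a model of Kripke–Platek set theory (without the axiom of infinity). **Theorem.** Let $\alpha>\omega$ be an admissible ordinal. Then $\alpha$ is $u$-weak if and only if $\alpha$ is wITRM-regular. -/

import Mathlib

universe u

/-! ### The constructible hierarchy -/

/-- The relation symbols of the language of set theory: one binary symbol. -/
inductive EpsRel : ℕ → Type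
  | mem : EpsRel 2

/-- The first-order language `{∈}` of set theory. -/
def setLang : FirstOrder.Language.{0, 0} := ⟨fun _ => Empty, EpsRel⟩

/-- The symbol `∈` of the language of set theory. -/
def memSymb : setLang.Relations 2 := EpsRel.mem

/-- A set `X` is viewed as the `∈`-structure `(X, ∈)`. -/
instance memStructure (X : ZFSet.{u}) : setLang.Structure {x : ZFSet.{u} // x ∈ X} where
  funMap f := nomatch f
  RelMap | EpsRel.mem => fun v => (v 0).1 ∈ (v 1).1

/-- `Def(X)`: the set of subsets of `X` that are first-order definable over `(X, ∈)` with
parameters from `X`. -/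
noncomputable def definablePowerset (X : ZFSet.{u}) : ZFSet.{u} :=
  ZFSet.sep
    (fun s => (Set.univ : Set {x : ZFSet.{u} // x ∈ X}).Definable₁ setLang {a | a.1 ∈ s})
    (ZFSet.powerset X)

/-- The constructible hierarchy, `L_α = ⋃_{β < α} Def(L_β)`. -/
noncomputable def constructibleLevel (α : Ordinal.{u}) : ZFSet.{u} :=
  ZFSet.iUnion fun β : Set.Iio α => definablePowerset (constructibleLevel β)
termination_by α
decreasing_by exact β.2

/-! ### Admissible ordinals -/

/-- The `Δ₀`-formulas of set theory: the least class of formulas that contains the atomic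
formulas and is closed under the connectives (all of which are expressed by `⊥` and `→`) and
under bounded quantification `∀ x ∈ y, φ`. -/
inductive IsDeltaZero {V : Type} : {n : ℕ} → setLang.BoundedFormula V n → Prop
  | falsum {n : ℕ} : IsDeltaZero (FirstOrder.Language.BoundedFormula.falsum (n := n))
  | equal {n : ℕ} (t₁ t₂ : setLang.Term (V ⊕ Fin n)) :
      IsDeltaZero (FirstOrder.Language.BoundedFormula.equal t₁ t₂)
  | rel {n l : ℕ} (R : setLang.Relations l) (ts : Fin l → setLang.Term (V ⊕ Fin n)) :
      IsDeltaZero (FirstOrder.Language.BoundedFormula.rel R ts)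
  | imp {n : ℕ} {φ ψ : setLang.BoundedFormula V n} :
      IsDeltaZero φ → IsDeltaZero ψ → IsDeltaZero (φ.imp ψ)
  | ball {n : ℕ} (y : V ⊕ Fin n) {φ : setLang.BoundedFormula V (n + 1)} :
      IsDeltaZero φ →
      IsDeltaZero (FirstOrder.Language.BoundedFormula.all (FirstOrder.Language.BoundedFormula.imp
        (memSymb.boundedFormula₂ (FirstOrder.Language.Term.var (Sum.inr (Fin.last n)))
          (FirstOrder.Language.Term.var (Sum.map id Fin.castSucc y))) φ))

/-- `M` is an admissible set: a nonempty transitive set such that `(M, ∈)` is a model of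
Kripke–Platek set theory. Extensionality and foundation hold in every transitive set, so only
pairing, union, `Δ₀`-separation and `Δ₀`-collection are listed. -/
structure IsAdmissibleSet (M : ZFSet.{u}) : Prop where
  nonempty : ∃ x, x ∈ M
  transitive : M.IsTransitive
  pairing : ∀ x ∈ M, ∀ y ∈ M, ∃ z ∈ M, x ∈ z ∧ y ∈ z
  union : ∀ x ∈ M, ∃ z ∈ M, ∀ y ∈ x, ∀ w ∈ y, w ∈ z
  separation : ∀ (k : ℕ) (φ : setLang.BoundedFormula (Fin k) 1), IsDeltaZero φ →
    ∀ (p : Fin k → {x : ZFSet.{u} // x ∈ M}) (a : {x : ZFSet.{u} // x ∈ M}),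
      ∃ b : {x : ZFSet.{u} // x ∈ M}, ∀ x : {x : ZFSet.{u} // x ∈ M},
        x.1 ∈ b.1 ↔ x.1 ∈ a.1 ∧ φ.Realize p ![x]
  collection : ∀ (k : ℕ) (φ : setLang.BoundedFormula (Fin k) 2), IsDeltaZero φ →
    ∀ (p : Fin k → {x : ZFSet.{u} // x ∈ M}) (a : {x : ZFSet.{u} // x ∈ M}),
      (∀ x : {x : ZFSet.{u} // x ∈ M}, x.1 ∈ a.1 →
        ∃ y : {x : ZFSet.{u} // x ∈ M}, φ.Realize p ![x, y]) →
      ∃ b : {x : ZFSet.{u} // x ∈ M}, ∀ x : {x : ZFSet.{u} // x ∈ M}, x.1 ∈ a.1 →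
        ∃ y : {x : ZFSet.{u} // x ∈ M}, y.1 ∈ b.1 ∧ φ.Realize p ![x, y]

/-- An ordinal `α` is admissible if `L_α` is an admissible set. -/
def IsAdmissibleOrdinal (α : Ordinal.{u}) : Prop :=
  IsAdmissibleSet (constructibleLevel α)

/-! ### Weak infinite time register machines -/

/-- Jump conditions: Boolean combinations of statements `R_i = R_j`. -/
inductive JumpCond : Type
  | eq (i j : ℕ)
  | not (b : JumpCond)
  | and (b c : JumpCond)
  | or (b c : JumpCond)

/-- Truth of a jump condition for given register contents. -/
def JumpCond.Holds (r : ℕ → Ordinal.{u}) : JumpCond → Prop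
  | .eq i j => r i = r j
  | .not b => ¬ b.Holds r
  | .and b c => b.Holds r ∧ c.Holds r
  | .or b c => b.Holds r ∨ c.Holds r

/-- Register machine instructions: set `R_i` to `0`, add `1` to `R_i`, copy `R_i` to `R_j`,
and jump to line `l` if the condition `b` holds. -/
inductive RegInstr : Type
  | zero (i : ℕ)
  | succ (i : ℕ)
  | copy (i j : ℕ)
  | jump (b : JumpCond) (l : ℕ)

/-- A program is a finite list of instructions; its lines are numbered from `0`. -/
abbrev RegProgram : Type := List RegInstr

/-- A configuration: the active program line and the register contents. A program mentions only
finitely many of the registers, and the others keep their initial content. -/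
@[ext]
structure RegConfig : Type (u + 1) where
  line : ℕ
  reg : ℕ → Ordinal.{u}

/-- The initial configuration with the inputs `v` in the first registers and `0` in all others. -/
def RegConfig.init (v : List Ordinal.{u}) : RegConfig.{u} where
  line := 0
  reg i := v.getD i 0

/-- The program has stopped when the active line is not a line of the program. -/
def RegConfig.IsHalted (P : RegProgram) (c : RegConfig.{u}) : Prop :=
  P.length ≤ c.line

open Classical in
/-- Execution of a single instruction. -/
noncomputable def RegInstr.exec (c : RegConfig.{u}) : RegInstr → RegConfig.{u}
  | .zero i => ⟨c.line + 1, Function.update c.reg i 0⟩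
  | .succ i => ⟨c.line + 1, Function.update c.reg i (c.reg i + 1)⟩
  | .copy i j => ⟨c.line + 1, Function.update c.reg j (c.reg i)⟩
  | .jump b l => ⟨if b.Holds c.reg then l else c.line + 1, c.reg⟩

/-- One step of the program `P`: execution of the instruction in the active line. -/
noncomputable def RegConfig.step (P : RegProgram) (c : RegConfig.{u}) : RegConfig.{u} :=
  match P[c.line]? with
  | some I => I.exec c
  | none => c

/-- The inferior limit `sup_{s < l} inf_{s ≤ t < l} f t` of `f` at a limit ordinal `l`. -/
noncomputable def liminfBelow {X : Type*} [ConditionallyCompleteLinearOrder X]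
    (f : Ordinal.{u} → X) (l : Ordinal.{u}) : X :=
  ⨆ s : Set.Iio l, ⨅ t : Set.Ico s.1 l, f t.1

/-- `HaltsIn α P c γ d`: the `α`-wITRM-computation of `P` that starts in the configuration `c`
halts in exactly `γ` many steps, in the configuration `d`. The sequence `C` restricted to the
times `≤ γ` is that computation. All register contents are `< α`; in particular the inferior
limits at limit times are `< α`, since otherwise the computation would crash. -/
def HaltsIn (α : Ordinal.{u}) (P : RegProgram) (c : RegConfig.{u}) (γ : Ordinal.{u})
    (d : RegConfig.{u}) : Prop :=
  ∃ C : Ordinal.{u} → RegConfig.{u},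
    C 0 = c ∧
    (∀ t ≤ γ, ∀ i, (C t).reg i < α) ∧
    (∀ t < γ, ¬ (C t).IsHalted P ∧ C (t + 1) = (C t).step P) ∧
    (∀ l ≤ γ, Order.IsSuccLimit l →
      (C l).line = liminfBelow (fun t => (C t).line) l ∧
      ∀ i, (C l).reg i = liminfBelow (fun t => (C t).reg i) l) ∧
    C γ = d ∧ d.IsHalted P

/-- `γ` is `α`-wITRM-clockable: for some program `P` and some `ζ < α`, the computation `P(ζ)`
halts in exactly `γ` many steps. -/
def IsClockable (α γ : Ordinal.{u}) : Prop :=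
  ∃ P : RegProgram, ∃ ζ < α, ∃ d, HaltsIn α P (RegConfig.init [ζ]) γ d

/-- `α` is `u`-weak: all `α`-wITRM-clockable ordinals are smaller than `α`. -/
def IsUWeak (α : Ordinal.{u}) : Prop :=
  ∀ γ, IsClockable α γ → γ < α

/-- `f : β → α` is `α`-wITRM-computable: for some program `P` and some parameter `ξ < α`, the
computation `P(ι, ξ)` halts with output `f ι` in the first register, for all `ι < β`. -/
def IsComputableFun (α : Ordinal.{u}) {β : Ordinal.{u}} (f : Set.Iio β → Set.Iio α) : Prop :=
  ∃ P : RegProgram, ∃ ξ < α, ∀ ι : Set.Iio β, ∃ γ d,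
    HaltsIn α P (RegConfig.init [ι.1, ξ]) γ d ∧ d.reg 0 = (f ι).1

/-- `α` is wITRM-singular: for some `β < α` there is an `α`-wITRM-computable cofinal function
from `β` to `α`. -/
def IsWITRMSingular (α : Ordinal.{u}) : Prop :=
  ∃ β < α, ∃ f : Set.Iio β → Set.Iio α, IsCofinal (Set.range f) ∧ IsComputableFun α f

/-- `α` is wITRM-regular: it is not wITRM-singular. -/
def IsWITRMRegular (α : Ordinal.{u}) : Prop :=
  ¬ IsWITRMSingular α

/-! Both directions rest on programs that simulate other programs through limit times. A loop can be
iterated transfinitely if its head is its lowest line and if, during each pass, no register falls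
below the smaller of its contents at the two ends of the pass. The configuration at a limit of
passes is then the inferior limit of the configurations at the loop head (`Reach.iterate`,
`Exec.loop`). An interpreter whose passes correspond to single steps of `P` therefore simulates `P`
correctly at limits as well (`runs_simLoop`). Several parameters are packed into a single one by
enumerating pairs of ordinals (`exists_load`); the necessary closure of `α` under pair coding
follows from either side of the equivalence.

Weak implies regular: given a computable cofinal `f : β → α`, a program computes all values `f ι` in
turn and spends more than `f ι` steps counting up to each of them. It halts, but no value of `f`
reaches its running time, so that time cannot be below `α`.

Regular implies weak: let `P(ζ)` halt at a time `≥ α`. The configuration `e` at time `α` does not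
recur cofinally below `α`, since otherwise the computation would cycle forever
(`exists_forall_comp_ne`). From some time `s < α` on, reaching `e` thus identifies the time `α`,
which no register can hold. There are two cases.

If some register `j` falls cofinally often below its content `ρ` at time `α`, send `η < ρ` to the
least time `T ≥ s` from which on the content `η` no longer occurs in it before `α`. This map is
cofinal, and it is computable because simulations can be stopped at `e`
(`LongRun.isWITRMSingular_of_frequently_lt`).

Otherwise all components eventually stay at or above those of `e`, hence meet them cofinally often.
Divide the time after `s` into rounds in each of which every component of `e` is met. If the ends of
the first `ω` rounds had a supremum below `α`, the configuration there would be `e`. So these ends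
give a computable cofinal map from `ω` (`LongRun.isWITRMSingular_of_eventually_le`). -/

/-! ### Inferior limits along ordinals -/

/-- `v` is the inferior limit of `f` at the limit ordinal `l`. -/
def IsLiminf {X : Type*} [LinearOrder X] (f : Ordinal.{u} → X) (l : Ordinal.{u}) (v : X) : Prop :=
  (∀ w < v, ∃ s < l, ∀ t, s ≤ t → t < l → w < f t) ∧ ∀ s < l, ∃ t, s ≤ t ∧ t < l ∧ f t ≤ v

namespace IsLiminf

variable {X : Type*} [LinearOrder X] {f g : Ordinal.{u} → X} {l : Ordinal.{u}} {v w : X}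

theorem le (hf : IsLiminf f l v) (hg : IsLiminf g l w) (h : ∀ t < l, f t ≤ g t) : v ≤ w := by
  by_contra! hlt
  obtain ⟨s, hs, h1⟩ := hf.1 _ hlt
  obtain ⟨t, hst, htl, h2⟩ := hg.2 s hs
  exact absurd ((h1 t hst htl).trans_le ((h t htl).trans h2)) (lt_irrefl _)

theorem unique (hf : IsLiminf f l v) (hg : IsLiminf f l w) : v = w :=
  le_antisymm (hf.le hg fun _ _ => le_rfl) (hg.le hf fun _ _ => le_rfl)

theorem congr (hf : IsLiminf f l v) (h : ∀ t < l, f t = g t) : IsLiminf g l v := by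
  refine ⟨fun w hw => ?_, fun s hs => ?_⟩
  · obtain ⟨s, hs, h1⟩ := hf.1 w hw
    exact ⟨s, hs, fun t h2 h3 => h t h3 ▸ h1 t h2 h3⟩
  · obtain ⟨t, h1, h2, h3⟩ := hf.2 s hs
    exact ⟨t, h1, h2, h t h2 ▸ h3⟩

theorem const (hl : 0 < l) (v : X) : IsLiminf (fun _ => v) l v :=
  ⟨fun _ hw => ⟨0, hl, fun _ _ _ => hw⟩, fun s hs => ⟨s, le_rfl, hs, le_rfl⟩⟩

/-- The inferior limit is at most any bound that holds cofinally. -/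
theorem le_of_frequently (hf : IsLiminf f l v) (h : ∀ s < l, ∃ t, s ≤ t ∧ t < l ∧ f t ≤ w) :
    v ≤ w := by
  by_contra! hlt
  obtain ⟨s, hs, h1⟩ := hf.1 _ hlt
  obtain ⟨t, hst, htl, h2⟩ := h s hs
  exact absurd (h1 t hst htl) h2.not_gt

/-- Only a tail matters for an inferior limit, so a computation may be restarted at any time. -/
theorem shift_iff (a : Ordinal.{u}) {b : Ordinal.{u}} (hb : Order.IsSuccLimit b) :
    IsLiminf f (a + b) v ↔ IsLiminf (fun t => f (a + t)) b v := by
  have hb0 : 0 < b := hb.bot_lt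
  constructor
  · refine fun hf => ⟨fun w hw => ?_, fun s hs => ?_⟩
    · obtain ⟨s, hs, h1⟩ := hf.1 w hw
      obtain ⟨d, hd, hsd⟩ := (Ordinal.lt_add_iff hb0.ne').1 hs
      exact ⟨d, hd, fun t h2 h3 => h1 _ (hsd.trans (by gcongr)) (by gcongr)⟩
    · obtain ⟨t, h1, h2, h3⟩ := hf.2 (a + s) (by gcongr)
      refine ⟨t - a, ?_, ?_, ?_⟩
      · exact Ordinal.le_sub_of_add_le h1
      · exact Ordinal.sub_lt_of_lt_add h2 hb0
      · simpa only [Ordinal.add_sub_cancel_of_le (le_self_add.trans h1)] using h3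
  · refine fun hf => ⟨fun w hw => ?_, fun s hs => ?_⟩
    · obtain ⟨s, hs, h1⟩ := hf.1 w hw
      refine ⟨a + s, by gcongr, fun t h2 h3 => ?_⟩
      have := h1 (t - a) (Ordinal.le_sub_of_add_le h2) (Ordinal.sub_lt_of_lt_add h3 hb0)
      simpa only [Ordinal.add_sub_cancel_of_le (le_self_add.trans h2)] using this
    · obtain ⟨d, hd, hsd⟩ := (Ordinal.lt_add_iff hb0.ne').1 hs
      obtain ⟨t, h1, h2, h3⟩ := hf.2 d hd
      exact ⟨a + t, hsd.trans (by gcongr), by gcongr, h3⟩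

/-- A simulated program line is a natural number, but it is stored as an ordinal in a register. -/
theorem cast {f : Ordinal.{u} → ℕ} {k : ℕ} (hf : IsLiminf f l k) :
    IsLiminf (fun t => (f t : Ordinal.{u})) l (k : Ordinal.{u}) := by
  refine ⟨fun w hw => ?_, fun s hs => ?_⟩
  · obtain ⟨n, rfl⟩ := Ordinal.lt_omega0.1 (hw.trans (Ordinal.natCast_lt_omega0 k))
    obtain ⟨s, hs, h⟩ := hf.1 n (by exact_mod_cast hw)
    exact ⟨s, hs, fun t h1 h2 => Nat.cast_lt.2 (h t h1 h2)⟩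
  · obtain ⟨t, h1, h2, h3⟩ := hf.2 s hs
    exact ⟨t, h1, h2, Nat.cast_le.2 h3⟩

/-- A nondecreasing function which is continuous at `l` has its value at `l` as inferior limit. -/
theorem of_monotone (h : ∀ s t, s ≤ t → t < l → f s ≤ f t)
    (hv : ∀ t < l, f t ≤ v) (hlub : ∀ w < v, ∃ s < l, w < f s) : IsLiminf f l v :=
  ⟨fun w hw => let ⟨s, hs, h1⟩ := hlub w hw; ⟨s, hs, fun t h2 h3 => h1.trans_le (h s t h2 h3)⟩,
    fun s hs => ⟨s, le_rfl, hs, hv s hs⟩⟩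

theorem id (hl : Order.IsSuccLimit l) : IsLiminf (fun t => t) l l :=
  of_monotone (fun _ _ h _ => h) (fun _ h => h.le)
    fun w hw => ⟨w + 1, hl.add_one_lt hw, lt_add_one w⟩

theorem add_left (a : Ordinal.{u}) (hl : Order.IsSuccLimit l) :
    IsLiminf (fun t => a + t) l (a + l) :=
  of_monotone (fun _ _ h _ => by gcongr) (fun _ h => by gcongr)
    fun w hw => (Ordinal.lt_add_iff_of_isSuccLimit hl).1 hw

/-- Used for simulated lines, which are truncated at the program length, and for step counters that
stop at a threshold. -/
theorem min_right (hf : IsLiminf f l v) (w : X) :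
    IsLiminf (fun t => min (f t) w) l (min v w) := by
  refine ⟨fun x hx => ?_, fun s hs => ?_⟩
  · obtain ⟨s, hs, h⟩ := hf.1 x (hx.trans_le (min_le_left _ _))
    exact ⟨s, hs, fun t h1 h2 => lt_min (h t h1 h2) (hx.trans_le (min_le_right _ _))⟩
  · obtain ⟨t, h1, h2, h3⟩ := hf.2 s hs
    exact ⟨t, h1, h2, min_le_min_right w h3⟩

end IsLiminf

/-- Infima are attained by well-foundedness. The boundedness hypothesis excludes the default value
of an unbounded supremum. -/
theorem isLiminf_liminfBelow {X : Type*} [ConditionallyCompleteLinearOrder X] [WellFoundedLT X]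
    [OrderBot X] (f : Ordinal.{u} → X) {l : Ordinal.{u}} (hl : 0 < l)
    (hb : BddAbove (Set.range fun s : Set.Iio l => ⨅ t : Set.Ico s.1 l, f t.1)) :
    IsLiminf f l (liminfBelow f l) := by
  have hbelow : ∀ s, BddBelow (Set.range fun t : Set.Ico s l => f t.1) := fun s =>
    OrderBot.bddBelow _
  have : Nonempty (Set.Iio l) := ⟨⟨0, hl⟩⟩
  refine ⟨fun w hw => ?_, fun s hs => ?_⟩
  · obtain ⟨s, hs⟩ := exists_lt_of_lt_ciSup hw
    exact ⟨s, s.2, fun t h1 h2 => hs.trans_le (ciInf_le (hbelow _) (⟨t, h1, h2⟩ : Set.Ico s.1 l))⟩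
  · have : Nonempty (Set.Ico s l) := ⟨⟨s, le_rfl, hs⟩⟩
    obtain ⟨t, ht⟩ := ciInf_mem fun t : Set.Ico s l => f t.1
    exact ⟨t, t.2.1, t.2.2, ht.trans_le (le_ciSup hb (⟨s, hs⟩ : Set.Iio l))⟩

theorem isLiminf_liminfBelow_ordinal (f : Ordinal.{u} → Ordinal.{u}) {l : Ordinal.{u}}
    (hl : 0 < l) : IsLiminf f l (liminfBelow f l) :=
  isLiminf_liminfBelow f hl Ordinal.bddAbove_of_small

theorem isLiminf_liminfBelow_nat (f : Ordinal.{u} → ℕ) {l : Ordinal.{u}} (hl : 0 < l) {B : ℕ}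
    (hB : ∀ t < l, f t ≤ B) : IsLiminf f l (liminfBelow f l) := by
  refine isLiminf_liminfBelow f hl ⟨B, ?_⟩
  rintro _ ⟨s, rfl⟩
  exact (ciInf_le (OrderBot.bddBelow _) (⟨s.1, le_rfl, s.2⟩ : Set.Ico s.1 l)).trans (hB _ s.2)

/-! ### The computation of a program as a total function -/

/-- The computation of `P` from the configuration `c`, with no bound on the register contents. -/
noncomputable def comp (P : RegProgram) (c : RegConfig.{u}) (t : Ordinal.{u}) : RegConfig.{u} :=
  Ordinal.limitRecOn t c (fun _ x => x.step P) fun l _ ih =>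
    ⟨liminfBelow (fun t => if h : t < l then (ih t h).line else 0) l,
      fun i => liminfBelow (fun t => if h : t < l then (ih t h).reg i else 0) l⟩

theorem comp_zero (P : RegProgram) (c : RegConfig.{u}) : comp P c 0 = c :=
  Ordinal.limitRecOn_zero ..

theorem comp_add_one (P : RegProgram) (c : RegConfig.{u}) (t : Ordinal.{u}) :
    comp P c (t + 1) = (comp P c t).step P :=
  Ordinal.limitRecOn_add_one ..

theorem liminfBelow_congr {X : Type*} [ConditionallyCompleteLinearOrder X]
    {f g : Ordinal.{u} → X} {l : Ordinal.{u}} (h : ∀ t < l, f t = g t) :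
    liminfBelow f l = liminfBelow g l := by
  unfold liminfBelow
  congr! 2 with s
  congr! 2 with t
  exact h _ t.2.2

theorem comp_limit (P : RegProgram) (c : RegConfig.{u}) {l : Ordinal.{u}}
    (hl : Order.IsSuccLimit l) :
    comp P c l = ⟨liminfBelow (fun t => (comp P c t).line) l,
      fun i => liminfBelow (fun t => (comp P c t).reg i) l⟩ := by
  unfold comp
  rw [Ordinal.limitRecOn_limit _ _ _ _ hl]
  congr 1
  · exact liminfBelow_congr fun t ht => by simp [ht]
  · funext i
    exact liminfBelow_congr fun t ht => by simp [ht]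

/-- A bound on the lines which `I` may lead to, other than the next one. -/
def RegInstr.target : RegInstr → ℕ
  | .jump _ l => l
  | _ => 0

/-- A bound on the lines that a computation of `P` may reach. -/
def lineBound (P : RegProgram) : ℕ := P.length + (P.map RegInstr.target).sum

theorem step_line_le (P : RegProgram) (c : RegConfig.{u}) {B : ℕ} (hB : lineBound P ≤ B)
    (hc : c.line ≤ B) : (c.step P).line ≤ B := by
  unfold RegConfig.step
  split
  · rename_i I hI
    have h1 : c.line < P.length := by
      by_contra! h
      simp [List.getElem?_eq_none h] at hI
    have h2 : I.target ≤ (P.map RegInstr.target).sum :=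
      List.single_le_sum (by simp) _ (List.mem_map_of_mem (List.mem_of_getElem? hI))
    unfold lineBound at hB
    cases I with
    | jump b l =>
      simp only [RegInstr.exec, RegInstr.target] at h2 ⊢
      split <;> omega
    | _ => simp only [RegInstr.exec]; omega
  · exact hc

/-- Makes the supremum over `ℕ` in the limit rule for lines a genuine one. -/
theorem comp_line_le (P : RegProgram) (c : RegConfig.{u}) (t : Ordinal.{u}) :
    (comp P c t).line ≤ max (lineBound P) c.line := by
  induction t using Ordinal.limitRecOn with
  | zero => simp [comp_zero]
  | add_one t ih => rw [comp_add_one]; exact step_line_le P _ (le_max_left _ _) ih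
  | limit l hl ih =>
    rw [comp_limit P c hl]
    exact (isLiminf_liminfBelow_nat _ hl.bot_lt ih).le (IsLiminf.const hl.bot_lt _) ih

/-- `A l` is the inferior limit of the configurations `A t`, `t < l`. -/
def IsLiminfConfig (A : Ordinal.{u} → RegConfig.{u}) (l : Ordinal.{u}) (c : RegConfig.{u}) :
    Prop :=
  IsLiminf (fun t => (A t).line) l c.line ∧ ∀ i, IsLiminf (fun t => (A t).reg i) l (c.reg i)

theorem IsLiminfConfig.unique {A : Ordinal.{u} → RegConfig.{u}} {l : Ordinal.{u}}
    {c d : RegConfig.{u}} (hc : IsLiminfConfig A l c) (hd : IsLiminfConfig A l d) : c = d :=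
  RegConfig.ext (hc.1.unique hd.1) (funext fun i => (hc.2 i).unique (hd.2 i))

theorem isLiminfConfig_comp (P : RegProgram) (c : RegConfig.{u}) {l : Ordinal.{u}}
    (hl : Order.IsSuccLimit l) : IsLiminfConfig (comp P c) l (comp P c l) := by
  have h := comp_limit P c hl
  refine ⟨?_, fun i => ?_⟩
  · rw [h]; exact isLiminf_liminfBelow_nat _ hl.bot_lt fun t _ => comp_line_le P c t
  · rw [h]; exact isLiminf_liminfBelow_ordinal _ hl.bot_lt

theorem comp_add (P : RegProgram) (c : RegConfig.{u}) (s t : Ordinal.{u}) :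
    comp P c (s + t) = comp P (comp P c s) t := by
  induction t using Ordinal.limitRecOn with
  | zero => simp [comp_zero]
  | add_one t ih => rw [← add_assoc, comp_add_one, comp_add_one, ih]
  | limit l hl ih =>
    have h1 := isLiminfConfig_comp P c (Ordinal.isSuccLimit_add s hl)
    have h2 := isLiminfConfig_comp P (comp P c s) hl
    refine IsLiminfConfig.unique (A := comp P (comp P c s)) ?_ h2
    exact ⟨((IsLiminf.shift_iff s hl).1 h1.1).congr fun t ht => by rw [ih t ht],
      fun i => ((IsLiminf.shift_iff s hl).1 (h1.2 i)).congr fun t ht => by rw [ih t ht]⟩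

/-- The rules determine the computation up to its halting time, so a witnessing sequence agrees with
`comp` there by induction on time. -/
theorem haltsIn_iff {α : Ordinal.{u}} {P : RegProgram} {c : RegConfig.{u}} {γ : Ordinal.{u}}
    {d : RegConfig.{u}} : HaltsIn α P c γ d ↔ (∀ t ≤ γ, ∀ i, (comp P c t).reg i < α) ∧
      (∀ t < γ, ¬ (comp P c t).IsHalted P) ∧ comp P c γ = d ∧ d.IsHalted P := by
  constructor
  · rintro ⟨C, h0, hα, hs, hl, hd, hh⟩
    have key : ∀ t ≤ γ, C t = comp P c t := by
      intro t
      induction t using Ordinal.limitRecOn with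
      | zero => simp [comp_zero, h0]
      | add_one t ih =>
        intro h
        have ht : t < γ := (lt_add_one t).trans_le h
        rw [(hs t ht).2, comp_add_one, ih ht.le]
      | limit l h ih =>
        intro hlγ
        have e : ∀ t < l, C t = comp P c t := fun t ht => ih t ht (ht.le.trans hlγ)
        refine (RegConfig.ext ?_ (funext fun i => ?_)).trans (comp_limit P c h).symm
        · rw [(hl l hlγ h).1]
          exact liminfBelow_congr fun t ht => congrArg RegConfig.line (e t ht)
        · rw [(hl l hlγ h).2]
          exact liminfBelow_congr fun t ht => congrArg (fun x => x.reg i) (e t ht)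
    exact ⟨fun t ht => key t ht ▸ hα t ht, fun t ht => key t ht.le ▸ (hs t ht).1,
      key γ le_rfl ▸ hd, hh⟩
  · rintro ⟨hα, hn, hd, hh⟩
    refine ⟨comp P c, comp_zero P c, hα, fun t ht => ⟨hn t ht, comp_add_one P c t⟩,
      fun l _ hl => ?_, hd, hh⟩
    constructor
    · rw [comp_limit P c hl]
    · intro i; rw [comp_limit P c hl]

/-! ### Reachability, and iteration along checkpoints -/

/-- `P` leads from `c` to `d` in `γ` many steps, and `I` holds at all times before. -/
def Reach (P : RegProgram) (I : RegConfig.{u} → Prop) (c : RegConfig.{u}) (γ : Ordinal.{u})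
    (d : RegConfig.{u}) : Prop :=
  comp P c γ = d ∧ ∀ t < γ, I (comp P c t)

theorem Reach.refl (P : RegProgram) (I : RegConfig.{u} → Prop) (c : RegConfig.{u}) :
    Reach P I c 0 c :=
  ⟨comp_zero P c, fun t ht => absurd ht (by simp)⟩

theorem Reach.single {P : RegProgram} {I : RegConfig.{u} → Prop} {c d : RegConfig.{u}}
    (h : c.step P = d) (hc : I c) : Reach P I c 1 d := by
  refine ⟨by rw [← zero_add (1 : Ordinal), comp_add_one, comp_zero, h], fun t ht => ?_⟩
  rw [Order.lt_one_iff.1 ht, comp_zero]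
  exact hc

theorem Reach.trans {P : RegProgram} {I : RegConfig.{u} → Prop} {c d e : RegConfig.{u}}
    {γ δ : Ordinal.{u}} (h : Reach P I c γ d) (h' : Reach P I d δ e) :
    Reach P I c (γ + δ) e := by
  refine ⟨by rw [comp_add, h.1, h'.1], fun t ht => ?_⟩
  rcases lt_or_ge t γ with htγ | htγ
  · exact h.2 t htγ
  · obtain ⟨x, rfl⟩ := le_iff_exists_add.1 htγ
    rw [comp_add, h.1]
    exact h'.2 x (lt_of_add_lt_add_left ht)

theorem Reach.mono {P : RegProgram} {I J : RegConfig.{u} → Prop} {c d : RegConfig.{u}}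
    {γ : Ordinal.{u}} (h : Reach P I c γ d) (hIJ : ∀ x, I x → J x) : Reach P J c γ d :=
  ⟨h.1, fun t ht => hIJ _ (h.2 t ht)⟩

/-- The sum of the ordinals `γ κ`, `κ < ι`. -/
noncomputable def osum (γ : Ordinal.{u} → Ordinal.{u}) (ι : Ordinal.{u}) : Ordinal.{u} :=
  Ordinal.limitRecOn ι 0 (fun κ x => x + γ κ) fun l _ ih => ⨆ κ : Set.Iio l, ih κ.1 κ.2

section osum

variable (γ : Ordinal.{u} → Ordinal.{u})

theorem osum_zero : osum γ 0 = 0 := Ordinal.limitRecOn_zero ..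

theorem osum_add_one (ι : Ordinal.{u}) : osum γ (ι + 1) = osum γ ι + γ ι :=
  Ordinal.limitRecOn_add_one ..

theorem osum_limit {l : Ordinal.{u}} (hl : Order.IsSuccLimit l) :
    osum γ l = ⨆ κ : Set.Iio l, osum γ κ.1 :=
  Ordinal.limitRecOn_limit _ _ _ _ hl

theorem lt_osum_limit {l t : Ordinal.{u}} (hl : Order.IsSuccLimit l) :
    t < osum γ l ↔ ∃ κ < l, t < osum γ κ := by
  rw [osum_limit γ hl, Ordinal.lt_iSup_iff]
  simp

theorem osum_mono {κ ι : Ordinal.{u}} (h : κ ≤ ι) : osum γ κ ≤ osum γ ι := by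
  induction ι using Ordinal.limitRecOn with
  | zero => rw [nonpos_iff_eq_zero.1 h]
  | add_one ι ih =>
    rcases h.eq_or_lt with rfl | h
    · rfl
    · rw [osum_add_one]
      exact (ih (Order.lt_add_one_iff.1 h)).trans le_self_add
  | limit l hl _ =>
    rcases h.eq_or_lt with rfl | h
    · rfl
    · rw [osum_limit γ hl]
      exact Ordinal.le_iSup (fun κ : Set.Iio l => osum γ κ.1) ⟨κ, h⟩

theorem exists_osum_le_lt {t ι : Ordinal.{u}} (h : t < osum γ ι) :
    ∃ κ < ι, osum γ κ ≤ t ∧ t < osum γ (κ + 1) := by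
  induction ι using Ordinal.limitRecOn with
  | zero => simp [osum_zero] at h
  | add_one ι ih =>
    rcases lt_or_ge t (osum γ ι) with h1 | h1
    · obtain ⟨κ, h2, h3⟩ := ih h1
      exact ⟨κ, h2.trans (lt_add_one ι), h3⟩
    · exact ⟨ι, lt_add_one ι, h1, h⟩
  | limit l hl ih =>
    obtain ⟨κ, hκ, h1⟩ := (lt_osum_limit γ hl).1 h
    obtain ⟨κ', h2, h3⟩ := ih κ hκ h1
    exact ⟨κ', h2.trans hκ, h3⟩

variable {γ}

theorem le_osum {ι : Ordinal.{u}} (h : ∀ κ < ι, 0 < γ κ) : ι ≤ osum γ ι := by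
  induction ι using Ordinal.limitRecOn with
  | zero => simp
  | add_one ι ih =>
    rw [osum_add_one]
    exact add_le_add (ih fun κ hκ => h κ (hκ.trans (lt_add_one ι)))
      (Order.one_le_iff_pos.2 (h ι (lt_add_one ι)))
  | limit l hl ih =>
    by_contra! hlt
    have := ih _ (hl.add_one_lt hlt) fun κ hκ => h κ (hκ.trans (hl.add_one_lt hlt))
    exact absurd ((lt_add_one _).trans_le this)
      (not_lt.2 (osum_mono γ (hl.add_one_lt hlt).le))

theorem osum_lt_osum {ι κ : Ordinal.{u}} (h : κ < ι) (hκ : 0 < γ κ) : osum γ κ < osum γ ι := by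
  refine lt_of_lt_of_le ?_ (osum_mono γ (Order.add_one_le_of_lt h))
  rw [osum_add_one]
  exact lt_add_of_pos_right _ hκ

theorem isSuccLimit_osum {l : Ordinal.{u}} (hl : Order.IsSuccLimit l) (h : ∀ κ < l, 0 < γ κ) :
    Order.IsSuccLimit (osum γ l) := by
  refine Ordinal.isSuccLimit_iff.2 ⟨(hl.bot_lt.trans_le (le_osum h)).ne', ?_⟩
  refine Order.isSuccPrelimit_of_succ_lt fun a ha => ?_
  obtain ⟨κ, hκ, h1⟩ := (lt_osum_limit γ hl).1 ha
  exact (Order.succ_le_of_lt h1).trans_lt (osum_lt_osum hκ (h κ hκ))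

end osum

/-- Values which between two consecutive checkpoints stay above the smaller of the two checkpoint
values have the same inferior limit as the checkpoint values. -/
theorem IsLiminf.of_checkpoints {X : Type*} [LinearOrder X] {γ : Ordinal.{u} → Ordinal.{u}}
    {f A : Ordinal.{u} → X} {l : Ordinal.{u}} {v : X} (hl : Order.IsSuccLimit l)
    (hγ : ∀ κ < l, 0 < γ κ) (hA : IsLiminf A l v) (hf : ∀ κ < l, f (osum γ κ) = A κ)
    (hmin : ∀ κ < l, ∀ t, osum γ κ ≤ t → t < osum γ (κ + 1) → min (A κ) (A (κ + 1)) ≤ f t) :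
    IsLiminf f (osum γ l) v := by
  refine ⟨fun w hw => ?_, fun s hs => ?_⟩
  · obtain ⟨κ, hκ, h1⟩ := hA.1 w hw
    refine ⟨osum γ κ, osum_lt_osum hκ (hγ κ hκ), fun t h2 h3 => ?_⟩
    obtain ⟨κ', h4, h5, h6⟩ := exists_osum_le_lt γ h3
    have h7 : κ ≤ κ' := by
      by_contra! h
      exact absurd (h6.trans_le (osum_mono γ (Order.add_one_le_of_lt h))) h2.not_gt
    exact (lt_min (h1 κ' h7 h4) (h1 _ (h7.trans (lt_add_one _).le) (hl.add_one_lt h4))).trans_le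
      (hmin κ' h4 t h5 h6)
  · obtain ⟨κ, hκ, h1⟩ := (lt_osum_limit γ hl).1 hs
    obtain ⟨κ', h2, h3, h4⟩ := hA.2 κ hκ
    exact ⟨osum γ κ', h1.le.trans (osum_mono γ h2), osum_lt_osum h3 (hγ _ h3), by rwa [hf κ' h3]⟩

/-- `c` is componentwise at least the minimum of `a` and `b`. -/
def AboveMin (a b c : RegConfig.{u}) : Prop :=
  min a.line b.line ≤ c.line ∧ ∀ i, min (a.reg i) (b.reg i) ≤ c.reg i

/-- Transfinite concatenation of blocks. Since each block stays above the minimum of its end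
configurations, the excursions inside the blocks do not lower the inferior limit, and at a limit of
blocks the computation arrives at the inferior limit of the checkpoints. -/
theorem Reach.iterate {P : RegProgram} {I : RegConfig.{u} → Prop}
    {A : Ordinal.{u} → RegConfig.{u}} {γ : Ordinal.{u} → Ordinal.{u}} {β : Ordinal.{u}}
    (hγ : ∀ ι < β, 0 < γ ι)
    (h : ∀ ι < β, Reach P (fun x => I x ∧ AboveMin (A ι) (A (ι + 1)) x) (A ι) (γ ι) (A (ι + 1)))
    (hlim : ∀ l ≤ β, Order.IsSuccLimit l → IsLiminfConfig A l (A l)) :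
    Reach P I (A 0) (osum γ β) (A β) := by
  have key : ∀ ι ≤ β, comp P (A 0) (osum γ ι) = A ι := by
    intro ι
    induction ι using Ordinal.limitRecOn with
    | zero => intro; rw [osum_zero, comp_zero]
    | add_one ι ih =>
      intro hι
      have hι' := (lt_add_one ι).trans_le hι
      rw [osum_add_one, comp_add, ih hι'.le, (h ι hι').1]
    | limit l hl ih =>
      intro hlβ
      have hγ' : ∀ κ < l, 0 < γ κ := fun κ hκ => hγ κ (hκ.trans_le hlβ)
      have hf : ∀ κ < l, comp P (A 0) (osum γ κ) = A κ := fun κ hκ => ih κ hκ (hκ.le.trans hlβ)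
      have hmin : ∀ κ < l, ∀ t, osum γ κ ≤ t → t < osum γ (κ + 1) →
          AboveMin (A κ) (A (κ + 1)) (comp P (A 0) t) := by
        intro κ hκ t h1 h2
        obtain ⟨x, rfl⟩ := le_iff_exists_add.1 h1
        rw [comp_add, hf κ hκ]
        rw [osum_add_one] at h2
        exact ((h κ (hκ.trans_le hlβ)).2 x (lt_of_add_lt_add_left h2)).2
      refine (isLiminfConfig_comp P (A 0) (isSuccLimit_osum hl hγ')).unique ?_
      exact ⟨.of_checkpoints hl hγ' (hlim l hlβ hl).1 (fun κ hκ => by rw [hf κ hκ])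
          fun κ hκ t h1 h2 => (hmin κ hκ t h1 h2).1,
        fun i => .of_checkpoints hl hγ' ((hlim l hlβ hl).2 i) (fun κ hκ => by rw [hf κ hκ])
          fun κ hκ t h1 h2 => (hmin κ hκ t h1 h2).2 i⟩
  refine ⟨key β le_rfl, fun t ht => ?_⟩
  obtain ⟨κ, hκ, h1, h2⟩ := exists_osum_le_lt γ ht
  obtain ⟨x, rfl⟩ := le_iff_exists_add.1 h1
  rw [comp_add, key κ hκ.le]
  rw [osum_add_one] at h2
  exact ((h κ hκ).2 x (lt_of_add_lt_add_left h2)).1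

/-! ### A structured language -/

/-- Structured programs, to be translated into register machine programs. -/
inductive Stmt : Type
  | skip
  | zero (i : ℕ)
  | succ (i : ℕ)
  | copy (i j : ℕ)
  | seq (s t : Stmt)
  | ite (b : JumpCond) (s t : Stmt)
  | loop (b : JumpCond) (s : Stmt)

infixr:65 " ;; " => Stmt.seq

namespace Stmt

/-- The number of instructions of the translation. -/
def len : Stmt → ℕ
  | skip => 0
  | zero _ => 1
  | succ _ => 1
  | copy _ _ => 1
  | seq s t => s.len + t.len
  | ite _ s t => t.len + 2 + s.len
  | loop _ s => s.len + 2

/-- The translation into a program whose first line has number `b`. -/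
def code : Stmt → ℕ → List RegInstr
  | skip, _ => []
  | zero i, _ => [.zero i]
  | succ i, _ => [.succ i]
  | copy i j, _ => [.copy i j]
  | seq s t, b => s.code b ++ t.code (b + s.len)
  | ite c s t, b => .jump c (b + t.len + 2) :: (t.code (b + 1) ++
      .jump (.eq 0 0) (b + t.len + 2 + s.len) :: s.code (b + t.len + 2))
  | loop c s, b => .jump (.not c) (b + s.len + 2) :: (s.code (b + 1) ++ [.jump (.eq 0 0) b])

theorem length_code (s : Stmt) (b : ℕ) : (s.code b).length = s.len := by
  induction s generalizing b with
  | seq s t hs ht => simp [code, len, hs, ht]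
  | ite c s t hs ht => simp [code, len, hs, ht]; omega
  | loop c s hs => simp [code, len, hs]
  | _ => rfl

/-- The translation of the given structured program occurs in `Q` from line `b` on. -/
def At (Q : RegProgram) : Stmt → ℕ → Prop
  | skip, _ => True
  | zero i, b => Q[b]? = some (.zero i)
  | succ i, b => Q[b]? = some (.succ i)
  | copy i j, b => Q[b]? = some (.copy i j)
  | seq s t, b => At Q s b ∧ At Q t (b + s.len)
  | ite c s t, b => Q[b]? = some (.jump c (b + t.len + 2)) ∧ At Q t (b + 1) ∧
      Q[b + 1 + t.len]? = some (.jump (.eq 0 0) (b + t.len + 2 + s.len)) ∧ At Q s (b + t.len + 2)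
  | loop c s, b => Q[b]? = some (.jump (.not c) (b + s.len + 2)) ∧ At Q s (b + 1) ∧
      Q[b + 1 + s.len]? = some (.jump (.eq 0 0) b)

theorem at_code (s : Stmt) (l r : List RegInstr) :
    s.At (l ++ s.code l.length ++ r) l.length := by
  induction s generalizing l r with
  | skip => trivial
  | zero i => simp [At, code]
  | succ i => simp [At, code]
  | copy i j => simp [At, code]
  | seq s t hs ht =>
    refine ⟨?_, ?_⟩
    · simpa [code] using hs l (t.code (l.length + s.len) ++ r)
    · simpa [code, length_code] using ht (l ++ s.code l.length) r
  | ite c s t hs ht =>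
    refine ⟨by simp [code], ?_, ?_, ?_⟩
    · have := ht (l ++ [.jump c (l.length + t.len + 2)])
        (.jump (.eq 0 0) (l.length + t.len + 2 + s.len) :: s.code (l.length + t.len + 2) ++ r)
      simp only [List.length_append, List.length_singleton] at this
      simpa [code] using this
    · have : l.length + 1 + t.len - l.length = t.len + 1 := by omega
      have h : ¬ l.length + 1 + t.len < l.length := by omega
      simp [code, List.getElem?_append, length_code, this, h]
    · have := hs (l ++ .jump c (l.length + t.len + 2) :: t.code (l.length + 1) ++
        [.jump (.eq 0 0) (l.length + t.len + 2 + s.len)]) r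
      simp only [List.length_append, List.length_cons, length_code, List.length_nil] at this
      have e : l.length + (t.len + 1) + (0 + 1) = l.length + t.len + 2 := by omega
      rw [e] at this
      simpa [code] using this
  | loop c s hs =>
    refine ⟨by simp [code], ?_, ?_⟩
    · have := hs (l ++ [.jump (.not c) (l.length + s.len + 2)]) (.jump (.eq 0 0) l.length :: r)
      simp only [List.length_append, List.length_singleton] at this
      simpa [code] using this
    · have : l.length + 1 + s.len - l.length = s.len + 1 := by omega
      have h : ¬ l.length + 1 + s.len < l.length := by omega
      simp [code, List.getElem?_append, length_code, this, h]

end Stmt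

/-- All contents are smaller than `α` and at least those of `m`. -/
def Within (α : Ordinal.{u}) (m σ : ℕ → Ordinal.{u}) : Prop :=
  m ≤ σ ∧ ∀ i, σ i < α

theorem Within.mono {α : Ordinal.{u}} {m m' σ : ℕ → Ordinal.{u}} (h : Within α m σ)
    (hm : m' ≤ m) : Within α m' σ :=
  ⟨hm.trans h.1, h.2⟩

/-- The structured program `s` leads from the register contents `σ` to `σ'` in `γ` many steps; all
contents stay `< α` and at least those of `m`. -/
def Exec (α : Ordinal.{u}) (m : ℕ → Ordinal.{u}) (s : Stmt) (σ : ℕ → Ordinal.{u})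
    (γ : Ordinal.{u}) (σ' : ℕ → Ordinal.{u}) : Prop :=
  ∀ (Q : RegProgram) (b : ℕ), s.At Q b →
    Reach Q (fun x => Within α m x.reg ∧ b ≤ x.line ∧ x.line < b + s.len) ⟨b, σ⟩ γ
      ⟨b + s.len, σ'⟩

theorem step_of_getElem? {P : RegProgram} {c : RegConfig.{u}} {I : RegInstr}
    (h : P[c.line]? = some I) : c.step P = I.exec c := by
  simp [RegConfig.step, h]

namespace Exec

variable {α : Ordinal.{u}} {m m' σ σ' σ'' : ℕ → Ordinal.{u}} {γ δ : Ordinal.{u}} {s t : Stmt}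
  {b : JumpCond}

theorem mono (h : Exec α m s σ γ σ') (hm : m' ≤ m) : Exec α m' s σ γ σ' := fun Q k hQ =>
  (h Q k hQ).mono fun _ hx => ⟨hx.1.mono hm, hx.2⟩

theorem skip : Exec α m .skip σ 0 σ := fun Q _ _ => Reach.refl Q _ _

theorem zero (h : Within α m σ) (i : ℕ) :
    Exec α m (.zero i) σ 1 (Function.update σ i 0) := fun Q k hQ =>
  .single (step_of_getElem? (c := ⟨k, σ⟩) hQ)
    ⟨h, le_rfl, by simp [Stmt.len]⟩

theorem succ (h : Within α m σ) (i : ℕ) :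
    Exec α m (.succ i) σ 1 (Function.update σ i (σ i + 1)) := fun Q k hQ =>
  .single (step_of_getElem? (c := ⟨k, σ⟩) hQ)
    ⟨h, le_rfl, by simp [Stmt.len]⟩

theorem copy (h : Within α m σ) (i j : ℕ) :
    Exec α m (.copy i j) σ 1 (Function.update σ j (σ i)) := fun Q k hQ =>
  .single (step_of_getElem? (c := ⟨k, σ⟩) hQ)
    ⟨h, le_rfl, by simp [Stmt.len]⟩

theorem seq (h : Exec α m s σ γ σ') (h' : Exec α m t σ' δ σ'') :
    Exec α m (s ;; t) σ (γ + δ) σ'' := by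
  rintro Q k ⟨hs, ht⟩
  have h1 := (h Q k hs).mono (J := fun x => Within α m x.reg ∧ k ≤ x.line ∧
    x.line < k + (s ;; t).len) fun x hx => ⟨hx.1, hx.2.1, by simp only [Stmt.len]; omega⟩
  have h2 := (h' Q _ ht).mono (J := fun x => Within α m x.reg ∧ k ≤ x.line ∧
    x.line < k + (s ;; t).len) fun x hx => ⟨hx.1, by omega, by simp only [Stmt.len]; omega⟩
  simpa only [Stmt.len, add_assoc] using h1.trans h2

theorem ite_true (hw : Within α m σ) (hb : b.Holds σ) (h : Exec α m s σ γ σ') :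
    Exec α m (.ite b s t) σ (1 + γ) σ' := by
  rintro Q k ⟨h1, -, -, h4⟩
  have r1 : Reach Q (fun x => Within α m x.reg ∧ k ≤ x.line ∧ x.line < k + (Stmt.ite b s t).len)
      ⟨k, σ⟩ 1 ⟨k + t.len + 2, σ⟩ :=
    .single (by rw [step_of_getElem? h1]; simp [RegInstr.exec, hb])
      ⟨hw, le_rfl, by simp only [Stmt.len]; omega⟩
  have r2 := (h Q _ h4).mono (J := fun x => Within α m x.reg ∧ k ≤ x.line ∧
    x.line < k + (Stmt.ite b s t).len) fun x hx => ⟨hx.1, by omega, by simp only [Stmt.len]; omega⟩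
  simpa only [Stmt.len, add_assoc] using r1.trans r2

theorem ite_false (hw : Within α m σ) (hb : ¬ b.Holds σ) (h : Exec α m t σ γ σ')
    (hw' : Within α m σ') : Exec α m (.ite b s t) σ (1 + γ + 1) σ' := by
  rintro Q k ⟨h1, h2, h3, -⟩
  have r1 : Reach Q (fun x => Within α m x.reg ∧ k ≤ x.line ∧ x.line < k + (Stmt.ite b s t).len)
      ⟨k, σ⟩ 1 ⟨k + 1, σ⟩ :=
    .single (by rw [step_of_getElem? h1]; simp [RegInstr.exec, hb])
      ⟨hw, le_rfl, by simp only [Stmt.len]; omega⟩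
  have r2 := (h Q _ h2).mono (J := fun x => Within α m x.reg ∧ k ≤ x.line ∧
    x.line < k + (Stmt.ite b s t).len) fun x hx => ⟨hx.1, by omega, by simp only [Stmt.len]; omega⟩
  have r3 : Reach Q (fun x => Within α m x.reg ∧ k ≤ x.line ∧ x.line < k + (Stmt.ite b s t).len)
      ⟨k + 1 + t.len, σ'⟩ 1 ⟨k + t.len + 2 + s.len, σ'⟩ :=
    .single (by rw [step_of_getElem? h3]; simp [RegInstr.exec, JumpCond.Holds])
      ⟨hw', by simp only; omega, by simp only [Stmt.len]; omega⟩
  simpa only [Stmt.len, add_assoc] using (r1.trans r2).trans r3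

theorem loop_false (hw : Within α m σ) (hb : ¬ b.Holds σ) : Exec α m (.loop b s) σ 1 σ := by
  rintro Q k ⟨h1, -, -⟩
  exact .single
    (by rw [step_of_getElem? h1]; simp [RegInstr.exec, hb, JumpCond.Holds, Stmt.len]; rfl)
    ⟨hw, le_rfl, by simp only [Stmt.len]; omega⟩

/-- One pass through the body of a loop. -/
theorem reach_body (hw : Within α m σ) (hb : b.Holds σ) (h : Exec α m s σ γ σ')
    (hw' : Within α m σ') {Q : RegProgram} {k : ℕ} (hQ : (Stmt.loop b s).At Q k) :
    Reach Q (fun x => Within α m x.reg ∧ k ≤ x.line ∧ x.line < k + (Stmt.loop b s).len)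
      ⟨k, σ⟩ (1 + γ + 1) ⟨k, σ'⟩ := by
  obtain ⟨h1, h2, h3⟩ := hQ
  have r1 : Reach Q (fun x => Within α m x.reg ∧ k ≤ x.line ∧ x.line < k + (Stmt.loop b s).len)
      ⟨k, σ⟩ 1 ⟨k + 1, σ⟩ :=
    .single (by rw [step_of_getElem? h1]; simp [RegInstr.exec, hb, JumpCond.Holds])
      ⟨hw, le_rfl, by simp only [Stmt.len]; omega⟩
  have r2 := (h Q _ h2).mono (J := fun x => Within α m x.reg ∧ k ≤ x.line ∧
    x.line < k + (Stmt.loop b s).len) fun x hx => ⟨hx.1, by omega, by simp only [Stmt.len]; omega⟩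
  have r3 : Reach Q (fun x => Within α m x.reg ∧ k ≤ x.line ∧ x.line < k + (Stmt.loop b s).len)
      ⟨k + 1 + s.len, σ'⟩ 1 ⟨k, σ'⟩ :=
    .single (by rw [step_of_getElem? h3]; simp [RegInstr.exec, JumpCond.Holds])
      ⟨hw', by simp only; omega, by simp only [Stmt.len]; omega⟩
  exact (r1.trans r2).trans r3

theorem loop_step (hw : Within α m σ) (hb : b.Holds σ) (h : Exec α m s σ γ σ')
    (hw' : Within α m σ') (h' : Exec α m (.loop b s) σ' δ σ'') :
    Exec α m (.loop b s) σ (1 + γ + 1 + δ) σ'' := fun Q k hQ =>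
  (reach_body hw hb h hw' hQ).trans (h' Q k hQ)

/-- The loop head is the lowest line of the loop, so it is again the active line at limits of
passes. The lower bound in `Exec` is there for this rule: the body must respect the minimum of the
contents before and after it. -/
theorem loop {σ : Ordinal.{u} → ℕ → Ordinal.{u}} {β : Ordinal.{u}}
    {γ : Ordinal.{u} → Ordinal.{u}} (hb : ∀ ι < β, b.Holds (σ ι)) (hβ : ¬ b.Holds (σ β))
    (hw : ∀ ι ≤ β, Within α m (σ ι))
    (h : ∀ ι < β, Exec α (σ ι ⊓ σ (ι + 1)) s (σ ι) (γ ι) (σ (ι + 1)))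
    (hlim : ∀ l ≤ β, Order.IsSuccLimit l → ∀ i, IsLiminf (fun t => σ t i) l (σ l i)) :
    Exec α m (.loop b s) (σ 0) (osum (fun ι => 1 + γ ι + 1) β + 1) (σ β) := by
  intro Q k hQ
  refine Reach.trans (d := ⟨k, σ β⟩) ?_ (loop_false (hw β le_rfl) hβ Q k hQ)
  refine Reach.iterate (A := fun ι => ⟨k, σ ι⟩) (fun ι _ => by simp) (fun ι hι => ?_) ?_
  · have hι' : ι + 1 ≤ β := Order.add_one_le_of_lt hι
    refine (reach_body (m := σ ι ⊓ σ (ι + 1)) ⟨inf_le_left, (hw ι hι.le).2⟩ (hb ι hι) (h ι hι)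
      ⟨inf_le_right, (hw _ hι').2⟩ hQ).mono fun x hx => ?_
    exact ⟨⟨hx.1.mono (le_inf (hw ι hι.le).1 (hw _ hι').1), hx.2⟩, by simpa using hx.2.1,
      fun i => hx.1.1 i⟩
  · exact fun l hl hlim' => ⟨IsLiminf.const hlim'.bot_lt k, fun i => hlim l hl hlim' i⟩

/-- A structured program, run on its own, halts. -/
theorem haltsIn (h : Exec α m s σ γ σ') (hσ' : ∀ i, σ' i < α) :
    HaltsIn α (s.code 0) ⟨0, σ⟩ γ ⟨s.len, σ'⟩ := by
  have hr := h (s.code 0) 0 (by simpa using s.at_code [] [])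
  simp only [zero_add] at hr
  refine haltsIn_iff.2 ⟨fun t ht i => ?_, fun t ht hh => ?_, hr.1, (s.length_code 0).le⟩
  · rcases ht.eq_or_lt with rfl | ht
    · rw [hr.1]; exact hσ' i
    · exact (hr.2 t ht).1.2 i
  · exact absurd (hr.2 t ht).2.2 (not_lt.2 ((s.length_code 0).symm.le.trans hh))

end Exec

/-- `s` leads from `σ` to `σ'` in some number of steps. -/
def Runs (α : Ordinal.{u}) (m : ℕ → Ordinal.{u}) (s : Stmt) (σ σ' : ℕ → Ordinal.{u}) : Prop :=
  ∃ γ, Exec α m s σ γ σ'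

namespace Runs

variable {α : Ordinal.{u}} {m m' σ σ' σ'' : ℕ → Ordinal.{u}} {s t : Stmt} {b : JumpCond}

theorem mono (h : Runs α m s σ σ') (hm : m' ≤ m) : Runs α m' s σ σ' :=
  h.imp fun _ h => h.mono hm

theorem skip : Runs α m .skip σ σ := ⟨_, Exec.skip⟩

theorem zero (h : Within α m σ) (i : ℕ) : Runs α m (.zero i) σ (Function.update σ i 0) :=
  ⟨_, Exec.zero h i⟩

theorem succ (h : Within α m σ) (i : ℕ) : Runs α m (.succ i) σ (Function.update σ i (σ i + 1)) :=
  ⟨_, Exec.succ h i⟩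

theorem copy (h : Within α m σ) (i j : ℕ) :
    Runs α m (.copy i j) σ (Function.update σ j (σ i)) :=
  ⟨_, Exec.copy h i j⟩

theorem seq (h : Runs α m s σ σ') (h' : Runs α m t σ' σ'') : Runs α m (s ;; t) σ σ'' := by
  obtain ⟨_, h⟩ := h
  obtain ⟨_, h'⟩ := h'
  exact ⟨_, h.seq h'⟩

theorem ite_true (hw : Within α m σ) (hb : b.Holds σ) (h : Runs α m s σ σ') :
    Runs α m (.ite b s t) σ σ' := by
  obtain ⟨_, h⟩ := h
  exact ⟨_, Exec.ite_true hw hb h⟩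

theorem ite_false (hw : Within α m σ) (hb : ¬ b.Holds σ) (h : Runs α m t σ σ')
    (hw' : Within α m σ') : Runs α m (.ite b s t) σ σ' := by
  obtain ⟨_, h⟩ := h
  exact ⟨_, Exec.ite_false hw hb h hw'⟩

theorem loop_false (hw : Within α m σ) (hb : ¬ b.Holds σ) : Runs α m (.loop b s) σ σ :=
  ⟨_, Exec.loop_false hw hb⟩

theorem loop_step (hw : Within α m σ) (hb : b.Holds σ) (h : Runs α m s σ σ')
    (hw' : Within α m σ') (h' : Runs α m (.loop b s) σ' σ'') : Runs α m (.loop b s) σ σ'' := by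
  obtain ⟨_, h⟩ := h
  obtain ⟨_, h'⟩ := h'
  exact ⟨_, Exec.loop_step hw hb h hw' h'⟩

end Runs

/-- A loop takes more steps than it has passes, and than each single pass has. -/
theorem exists_exec_loop {α : Ordinal.{u}} {m : ℕ → Ordinal.{u}} {s : Stmt} {b : JumpCond}
    {σ : Ordinal.{u} → ℕ → Ordinal.{u}} {β : Ordinal.{u}} {τ : Ordinal.{u} → Ordinal.{u}}
    (hb : ∀ ι < β, b.Holds (σ ι)) (hβ : ¬ b.Holds (σ β)) (hw : ∀ ι ≤ β, Within α m (σ ι))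
    (h : ∀ ι < β, ∃ γ, τ ι ≤ γ ∧ Exec α (σ ι ⊓ σ (ι + 1)) s (σ ι) γ (σ (ι + 1)))
    (hlim : ∀ l ≤ β, Order.IsSuccLimit l → ∀ i, IsLiminf (fun t => σ t i) l (σ l i)) :
    ∃ γ, β < γ ∧ (∀ ι < β, τ ι < γ) ∧ Exec α m (.loop b s) (σ 0) γ (σ β) := by
  choose! γ hγ h using h
  refine ⟨_, ?_, fun ι hι => ?_, Exec.loop hb hβ hw h hlim⟩
  · exact Order.lt_add_one_iff.2 (le_osum fun ι _ => by simp)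
  · refine Order.lt_add_one_iff.2 (le_trans ?_ (osum_mono _ (Order.add_one_le_of_lt hι)))
    rw [osum_add_one]
    exact (hγ ι hι).trans (le_add_self.trans (le_self_add.trans le_add_self))

theorem Runs.loop {α : Ordinal.{u}} {m : ℕ → Ordinal.{u}} {s : Stmt} {b : JumpCond}
    {σ : Ordinal.{u} → ℕ → Ordinal.{u}} {β : Ordinal.{u}}
    (hb : ∀ ι < β, b.Holds (σ ι)) (hβ : ¬ b.Holds (σ β)) (hw : ∀ ι ≤ β, Within α m (σ ι))
    (h : ∀ ι < β, Runs α (σ ι ⊓ σ (ι + 1)) s (σ ι) (σ (ι + 1)))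
    (hlim : ∀ l ≤ β, Order.IsSuccLimit l → ∀ i, IsLiminf (fun t => σ t i) l (σ l i)) :
    Runs α m (.loop b s) (σ 0) (σ β) := by
  obtain ⟨γ, -, -, h⟩ := exists_exec_loop (τ := 0) hb hβ hw
    (fun ι hι => (h ι hι).imp fun γ hγ => ⟨zero_le, hγ⟩) hlim
  exact ⟨γ, h⟩

namespace Runs

variable {α : Ordinal.{u}} {m σ σ' : ℕ → Ordinal.{u}} {s : Stmt}

theorem zero_seq {i : ℕ} (h : Within α m σ) (h' : Runs α m s (Function.update σ i 0) σ') :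
    Runs α m (.zero i ;; s) σ σ' :=
  (zero h i).seq h'

theorem succ_seq {i : ℕ} (h : Within α m σ)
    (h' : Runs α m s (Function.update σ i (σ i + 1)) σ') : Runs α m (.succ i ;; s) σ σ' :=
  (succ h i).seq h'

theorem copy_seq {i j : ℕ} (h : Within α m σ)
    (h' : Runs α m s (Function.update σ j (σ i)) σ') : Runs α m (.copy i j ;; s) σ σ' :=
  (copy h i j).seq h'

end Runs

/-! ### Register layout -/

/-- Seven control registers, followed by two interleaved sequences of registers. -/
def st (a x p q t T d : Ordinal.{u}) (r v : ℕ → Ordinal.{u}) : ℕ → Ordinal.{u}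
  | 0 => a
  | 1 => x
  | 2 => p
  | 3 => q
  | 4 => t
  | 5 => T
  | 6 => d
  | k + 7 => if k % 2 = 0 then r (k / 2) else v (k / 2)

/-- The index of the `j`-th register of the first sequence; it simulates the register `R_j`. -/
def sim (j : ℕ) : ℕ := 2 * j + 7

/-- The index of the `j`-th register of the second sequence; it contains the `j`-th parameter. -/
def par (j : ℕ) : ℕ := 2 * j + 1 + 7

section st

variable (a x p q t T d y : Ordinal.{u}) (r v : ℕ → Ordinal.{u}) (j : ℕ)

@[simp] theorem st_zero : st a x p q t T d r v 0 = a := rfl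
@[simp] theorem st_one : st a x p q t T d r v 1 = x := rfl
@[simp] theorem st_two : st a x p q t T d r v 2 = p := rfl
@[simp] theorem st_three : st a x p q t T d r v 3 = q := rfl
@[simp] theorem st_four : st a x p q t T d r v 4 = t := rfl
@[simp] theorem st_five : st a x p q t T d r v 5 = T := rfl
@[simp] theorem st_six : st a x p q t T d r v 6 = d := rfl

@[simp] theorem st_sim : st a x p q t T d r v (sim j) = r j := by
  have h : st a x p q t T d r v (sim j) = if 2 * j % 2 = 0 then r (2 * j / 2) else v (2 * j / 2) :=
    rfl
  simp [h]

@[simp] theorem st_par : st a x p q t T d r v (par j) = v j := by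
  have h : st a x p q t T d r v (par j) =
    if (2 * j + 1) % 2 = 0 then r ((2 * j + 1) / 2) else v ((2 * j + 1) / 2) := rfl
  have h2 : (2 * j + 1) / 2 = j := by omega
  simp [h, h2, Nat.add_mod]

theorem forall_index {p : ℕ → Prop} : (∀ i, p i) ↔ p 0 ∧ p 1 ∧ p 2 ∧ p 3 ∧ p 4 ∧ p 5 ∧ p 6 ∧
    (∀ j, p (sim j)) ∧ ∀ j, p (par j) := by
  refine ⟨fun h => by simp [h], ?_⟩
  rintro ⟨h0, h1, h2, h3, h4, h5, h6, hs, hp⟩ i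
  obtain h | ⟨j, h | h⟩ : i < 7 ∨ ∃ j, i = sim j ∨ i = par j := by
    by_cases h : i < 7
    · exact .inl h
    · exact .inr ⟨(i - 7) / 2, by unfold sim par; omega⟩
  · interval_cases i <;> assumption
  · exact h ▸ hs j
  · exact h ▸ hp j

theorem sim_ne_of_lt {i : ℕ} (h : i < 7) : sim j ≠ i := by unfold sim; omega

theorem par_ne_of_lt {i : ℕ} (h : i < 7) : par j ≠ i := by unfold par; omega

theorem sim_ne_par (i : ℕ) : sim j ≠ par i := by unfold sim par; omega

theorem sim_inj {i : ℕ} : sim i = sim j ↔ i = j := by unfold sim; omega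

theorem par_inj {i : ℕ} : par i = par j ↔ i = j := by unfold par; omega

theorem eq_st_iff {σ : ℕ → Ordinal.{u}} : σ = st a x p q t T d r v ↔
    σ 0 = a ∧ σ 1 = x ∧ σ 2 = p ∧ σ 3 = q ∧ σ 4 = t ∧ σ 5 = T ∧ σ 6 = d ∧
      (∀ j, σ (sim j) = r j) ∧ ∀ j, σ (par j) = v j := by
  rw [funext_iff, forall_index]
  simp

@[simp] theorem update_st_zero :
    Function.update (st a x p q t T d r v) 0 y = st y x p q t T d r v := by
  simp [eq_st_iff, sim_ne_of_lt, par_ne_of_lt]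

@[simp] theorem update_st_one :
    Function.update (st a x p q t T d r v) 1 y = st a y p q t T d r v := by
  simp [eq_st_iff, sim_ne_of_lt, par_ne_of_lt]

@[simp] theorem update_st_two :
    Function.update (st a x p q t T d r v) 2 y = st a x y q t T d r v := by
  simp [eq_st_iff, sim_ne_of_lt, par_ne_of_lt]

@[simp] theorem update_st_three :
    Function.update (st a x p q t T d r v) 3 y = st a x p y t T d r v := by
  simp [eq_st_iff, sim_ne_of_lt, par_ne_of_lt]

@[simp] theorem update_st_four :
    Function.update (st a x p q t T d r v) 4 y = st a x p q y T d r v := by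
  simp [eq_st_iff, sim_ne_of_lt, par_ne_of_lt]

@[simp] theorem update_st_five :
    Function.update (st a x p q t T d r v) 5 y = st a x p q t y d r v := by
  simp [eq_st_iff, sim_ne_of_lt, par_ne_of_lt]

@[simp] theorem update_st_six :
    Function.update (st a x p q t T d r v) 6 y = st a x p q t T y r v := by
  simp [eq_st_iff, sim_ne_of_lt, par_ne_of_lt]

@[simp] theorem update_st_sim : Function.update (st a x p q t T d r v) (sim j) y =
    st a x p q t T d (Function.update r j y) v := by
  simp [eq_st_iff, Function.update_apply, (sim_ne_of_lt _ _).symm, (sim_ne_par _ _).symm, sim_inj]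

@[simp] theorem update_st_par : Function.update (st a x p q t T d r v) (par j) y =
    st a x p q t T d r (Function.update v j y) := by
  simp [eq_st_iff, Function.update_apply, (par_ne_of_lt _ _).symm, sim_ne_par, par_inj]

variable {a x p q t T d r v}

theorem within_st_iff {α : Ordinal.{u}} {m : ℕ → Ordinal.{u}} :
    Within α m (st a x p q t T d r v) ↔ (m 0 ≤ a ∧ a < α) ∧ (m 1 ≤ x ∧ x < α) ∧
      (m 2 ≤ p ∧ p < α) ∧ (m 3 ≤ q ∧ q < α) ∧ (m 4 ≤ t ∧ t < α) ∧ (m 5 ≤ T ∧ T < α) ∧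
      (m 6 ≤ d ∧ d < α) ∧ (∀ j, m (sim j) ≤ r j ∧ r j < α) ∧ ∀ j, m (par j) ≤ v j ∧ v j < α := by
  unfold Within
  rw [Pi.le_def, ← forall_and, forall_index]
  simp

theorem isLiminf_st {a x p q t T d : Ordinal.{u} → Ordinal.{u}}
    {r v : Ordinal.{u} → ℕ → Ordinal.{u}} {l a' x' p' q' t' T' d' : Ordinal.{u}}
    {r' v' : ℕ → Ordinal.{u}} (ha : IsLiminf a l a') (hx : IsLiminf x l x')
    (hp : IsLiminf p l p') (hq : IsLiminf q l q') (ht : IsLiminf t l t') (hT : IsLiminf T l T')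
    (hd : IsLiminf d l d') (hr : ∀ j, IsLiminf (fun ι => r ι j) l (r' j))
    (hv : ∀ j, IsLiminf (fun ι => v ι j) l (v' j)) (i : ℕ) :
    IsLiminf (fun ι => st (a ι) (x ι) (p ι) (q ι) (t ι) (T ι) (d ι) (r ι) (v ι) i) l
      (st a' x' p' q' t' T' d' r' v' i) := by
  revert i
  rw [forall_index]
  simpa using ⟨ha, hx, hp, hq, ht, hT, hd, hr, hv⟩

end st

/-! ### Interpretation of register machine programs -/

/-- Store the number `k` in the register `i`. -/
def constStmt (i : ℕ) : ℕ → Stmt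
  | 0 => .zero i
  | k + 1 => constStmt i k ;; .succ i

/-- Store the number `k` in the register that simulates the active line. -/
def lineStmt (k : ℕ) : Stmt := constStmt 3 k ;; .copy 3 2 ;; .zero 3

/-- The condition `b` on the simulated registers. -/
def JumpCond.sim : JumpCond → JumpCond
  | .eq i j => .eq (_root_.sim i) (_root_.sim j)
  | .not b => .not b.sim
  | .and b c => .and b.sim c.sim
  | .or b c => .or b.sim c.sim

theorem JumpCond.holds_sim {b : JumpCond} {a x p q t T d : Ordinal.{u}} {r v : ℕ → Ordinal.{u}} :
    b.sim.Holds (st a x p q t T d r v) ↔ b.Holds r := by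
  induction b with
  | eq i j => simp [JumpCond.sim, JumpCond.Holds]
  | not b hb => simp [JumpCond.sim, JumpCond.Holds, hb]
  | and b c hb hc => simp [JumpCond.sim, JumpCond.Holds, hb, hc]
  | or b c hb hc => simp [JumpCond.sim, JumpCond.Holds, hb, hc]

/-- Simulation of an instruction in line `k` of a program of length `n`. -/
def instrStmt (n k : ℕ) : RegInstr → Stmt
  | .zero i => .zero (sim i) ;; lineStmt (k + 1)
  | .succ i => .succ (sim i) ;; lineStmt (k + 1)
  | .copy i j => .copy (sim i) (sim j) ;; lineStmt (k + 1)
  | .jump b l => .ite b.sim (lineStmt (min l n)) (lineStmt (k + 1))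

/-- Simulation of the active one of the instructions in lines `k`, `k + 1`, … of a program of
length `n`. -/
def dispatch (n : ℕ) : ℕ → List RegInstr → Stmt
  | _, [] => .zero 3
  | k, I :: L => constStmt 3 k ;; .ite (.eq 2 3) (.zero 3 ;; instrStmt n k I) (dispatch n (k + 1) L)

/-- Simulation of one step of `P`. -/
def interp (P : RegProgram) : Stmt := dispatch P.length 0 P

section interp

variable {α : Ordinal.{u}} {m : ℕ → Ordinal.{u}} {a x p q t T d : Ordinal.{u}}
  {r v : ℕ → Ordinal.{u}}

/-- Register 3 is scratch space: it is `0` between the simulated steps, so the lower bound imposes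
nothing on it. -/
theorem Within.st_three (h : Within α m (st a x p 0 t T d r v)) (hq : q < α) :
    Within α m (st a x p q t T d r v) := by
  rw [within_st_iff] at h ⊢
  exact ⟨h.1, h.2.1, h.2.2.1, ⟨h.2.2.2.1.1.trans zero_le, hq⟩, h.2.2.2.2⟩

theorem natCast_lt_of_omega0_lt (hα : Ordinal.omega0 < α) (k : ℕ) : (k : Ordinal.{u}) < α :=
  (Ordinal.natCast_lt_omega0 k).trans hα

theorem runs_constStmt (hα : Ordinal.omega0 < α) (hw : Within α m (st a x p 0 t T d r v))
    (hq : q < α) (k : ℕ) :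
    Runs α m (constStmt 3 k) (st a x p q t T d r v) (st a x p k t T d r v) := by
  induction k with
  | zero => simpa [constStmt] using Runs.zero (hw.st_three hq) 3
  | succ k ih =>
    refine ih.seq ?_
    simpa using Runs.succ (hw.st_three (natCast_lt_of_omega0_lt hα k)) 3

/-- The number is built up in register 3 and then copied. Building it in register 2 would make the
simulated line pass through `0` and spoil its inferior limits. -/
theorem runs_lineStmt (hα : Ordinal.omega0 < α) (hw : Within α m (st a x p 0 t T d r v)) (k : ℕ)
    (hw' : Within α m (st a x k 0 t T d r v)) :
    Runs α m (lineStmt k) (st a x p 0 t T d r v) (st a x k 0 t T d r v) := by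
  have hk := natCast_lt_of_omega0_lt hα k
  refine (runs_constStmt hα hw (hk.bot_lt) k).seq (.seq (Runs.copy (hw.st_three hk) 3 2) ?_)
  simpa using Runs.zero (hw'.st_three hk) 3

/-- Lines are truncated at `n`, so that all halted lines are represented by `n` and halting can be
tested by one equality. -/
theorem runs_instrStmt (hα : Ordinal.omega0 < α) {n : ℕ} {c : RegConfig.{u}} (hc : c.line < n)
    (I : RegInstr) (hw : Within α m (st a x c.line 0 t T d c.reg v))
    (hw' : Within α m (st a x (min (I.exec c).line n : ℕ) 0 t T d (I.exec c).reg v)) :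
    Runs α m (instrStmt n c.line I) (st a x c.line 0 t T d c.reg v)
      (st a x (min (I.exec c).line n : ℕ) 0 t T d (I.exec c).reg v) := by
  have e : min (c.line + 1) n = c.line + 1 := by omega
  -- The registers are updated before the line, so the old line occurs together with the new
  -- contents.
  have hmix : Within α m (st a x c.line 0 t T d (I.exec c).reg v) := by
    rw [within_st_iff] at hw hw' ⊢
    tauto
  cases I with
  | zero i =>
    simp only [RegInstr.exec, e] at hw' hmix ⊢
    have h := Runs.zero hw (sim i)
    simp only [update_st_sim] at h
    exact h.seq (runs_lineStmt hα hmix _ hw')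
  | succ i =>
    simp only [RegInstr.exec, e] at hw' hmix ⊢
    have h := Runs.succ hw (sim i)
    simp only [st_sim, update_st_sim] at h
    exact h.seq (runs_lineStmt hα hmix _ hw')
  | copy i j =>
    simp only [RegInstr.exec, e] at hw' hmix ⊢
    have h := Runs.copy hw (sim i) (sim j)
    simp only [st_sim, update_st_sim] at h
    exact h.seq (runs_lineStmt hα hmix _ hw')
  | jump b l =>
    simp only [RegInstr.exec] at hw' hmix ⊢
    by_cases hb : b.Holds c.reg
    · simp only [hb, if_true] at hw' ⊢
      exact .ite_true hw (JumpCond.holds_sim.2 hb) (runs_lineStmt hα hw _ hw')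
    · simp only [hb, if_false, e] at hw' ⊢
      exact .ite_false hw (by rwa [JumpCond.holds_sim]) (runs_lineStmt hα hw _ hw') hw'

theorem runs_dispatch (hα : Ordinal.omega0 < α) {n : ℕ} {c : RegConfig.{u}} (hc : c.line < n)
    {I : RegInstr} (hw : Within α m (st a x c.line 0 t T d c.reg v))
    (hw' : Within α m (st a x (min (I.exec c).line n : ℕ) 0 t T d (I.exec c).reg v))
    {L : List RegInstr} {i k : ℕ} (hI : L[i]? = some I) (hk : c.line = k + i) (hq : q < α) :
    Runs α m (dispatch n k L) (st a x c.line q t T d c.reg v)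
      (st a x (min (I.exec c).line n : ℕ) 0 t T d (I.exec c).reg v) := by
  induction L generalizing i k q with
  | nil => simp at hI
  | cons J L ih =>
    have hkα := natCast_lt_of_omega0_lt hα k
    refine (runs_constStmt hα hw hq k).seq ?_
    cases i with
    | zero =>
      obtain rfl : J = I := by simpa using hI
      obtain rfl : c.line = k := by simpa using hk
      refine .ite_true (hw.st_three hkα) (by simp [JumpCond.Holds]) (.seq ?_
        (runs_instrStmt hα hc J hw hw'))
      simpa using Runs.zero (hw.st_three hkα) 3
    | succ i =>
      refine .ite_false (hw.st_three hkα) ?_ (ih (i := i) (by simpa using hI) (by omega) hkα) hw'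
      simp only [JumpCond.Holds, st_two, st_three, Nat.cast_inj]
      omega

theorem runs_interp (hα : Ordinal.omega0 < α) {P : RegProgram} {c : RegConfig.{u}}
    (hc : ¬ c.IsHalted P)
    (hw : Within α m (st a x (min c.line P.length : ℕ) 0 t T d c.reg v))
    (hw' : Within α m (st a x (min (c.step P).line P.length : ℕ) 0 t T d (c.step P).reg v)) :
    Runs α m (interp P) (st a x (min c.line P.length : ℕ) 0 t T d c.reg v)
      (st a x (min (c.step P).line P.length : ℕ) 0 t T d (c.step P).reg v) := by
  have hlt : c.line < P.length := not_le.1 hc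
  have hI := List.getElem?_eq_getElem hlt
  rw [step_of_getElem? hI] at hw' ⊢
  rw [min_eq_left hlt.le] at hw ⊢
  exact runs_dispatch hα hlt hw hw' hI (by simp) (natCast_lt_of_omega0_lt hα 0 |>.bot_lt)

/-- Simulation of `P` as long as `b` holds; the steps at which `h` fails are counted. -/
def simLoop (P : RegProgram) (b h : JumpCond) : Stmt :=
  .loop b (.ite h .skip (.succ 4) ;; interp P)

/-- Pass `ι` of the loop performs step `ι` of `P`, also for infinite `ι`: at limits the loop rule
forms the same inferior limits as `P` itself. The function `e` is the content of the step counter,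
register 4. -/
theorem runs_simLoop (hα : Ordinal.omega0 < α) {P : RegProgram} {b h : JumpCond}
    {c : RegConfig.{u}} {e : Ordinal.{u} → Ordinal.{u}} {β : Ordinal.{u}}
    (hb : ∀ ι < β, b.Holds
      (st a x (min (comp P c ι).line P.length : ℕ) 0 (e ι) T d (comp P c ι).reg v))
    (hβ : ¬ b.Holds
      (st a x (min (comp P c β).line P.length : ℕ) 0 (e β) T d (comp P c β).reg v))
    (hh : ∀ ι < β,
      h.Holds (st a x (min (comp P c ι).line P.length : ℕ) 0 (e ι) T d (comp P c ι).reg v) ∧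
          e (ι + 1) = e ι ∨
      ¬ h.Holds (st a x (min (comp P c ι).line P.length : ℕ) 0 (e ι) T d (comp P c ι).reg v) ∧
          e (ι + 1) = e ι + 1)
    (he : ∀ l ≤ β, Order.IsSuccLimit l → IsLiminf e l (e l))
    (hw : ∀ ι ≤ β, Within α m
      (st a x (min (comp P c ι).line P.length : ℕ) 0 (e ι) T d (comp P c ι).reg v))
    (hn : ∀ ι < β, ¬ (comp P c ι).IsHalted P) :
    Runs α m (simLoop P b h) (st a x (min c.line P.length : ℕ) 0 (e 0) T d c.reg v)
      (st a x (min (comp P c β).line P.length : ℕ) 0 (e β) T d (comp P c β).reg v) := by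
  have key := Runs.loop (α := α) (m := m) (b := b) (β := β)
    (s := .ite h .skip (.succ 4) ;; interp P)
    (σ := fun ι => st a x (min (comp P c ι).line P.length : ℕ) 0 (e ι) T d (comp P c ι).reg v)
    hb hβ hw (fun ι hι => ?_) (fun l hl hlim => ?_)
  · rwa [comp_zero] at key
  · have hι' := Order.add_one_le_of_lt hι
    generalize hm : st a x (min (comp P c ι).line P.length : ℕ) 0 (e ι) T d (comp P c ι).reg v ⊓
      st a x (min (comp P c (ι + 1)).line P.length : ℕ) 0 (e (ι + 1)) T d
        (comp P c (ι + 1)).reg v = m'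
    have w0 : Within α m'
        (st a x (min (comp P c ι).line P.length : ℕ) 0 (e ι) T d (comp P c ι).reg v) :=
      ⟨hm ▸ inf_le_left, (hw ι hι.le).2⟩
    have w1 : Within α m' (st a x (min (comp P c (ι + 1)).line P.length : ℕ) 0 (e (ι + 1)) T d
        (comp P c (ι + 1)).reg v) :=
      ⟨hm ▸ inf_le_right, (hw _ hι').2⟩
    have w2 : Within α m' (st a x (min (comp P c ι).line P.length : ℕ) 0 (e (ι + 1)) T d
        (comp P c ι).reg v) := by
      rw [within_st_iff] at w0 w1 ⊢
      tauto
    refine Runs.seq (σ' := st a x (min (comp P c ι).line P.length : ℕ) 0 (e (ι + 1)) T d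
        (comp P c ι).reg v) ?_ ?_
    · rcases hh ι hι with ⟨h1, h2⟩ | ⟨h1, h2⟩
      · rw [h2]
        exact .ite_true w0 h1 .skip
      · refine .ite_false w0 h1 ?_ w2
        simpa [h2] using Runs.succ w0 4
    · rw [comp_add_one] at w1 ⊢
      exact runs_interp hα (hn ι hι) w2 w1
  · have hl0 := hlim.bot_lt
    have hc := isLiminfConfig_comp P c hlim
    exact isLiminf_st (.const hl0 _) (.const hl0 _) (hc.1.min_right _).cast (.const hl0 _)
      (he l hl hlim) (.const hl0 _) (.const hl0 _) hc.2 fun _ => .const hl0 _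

end interp

theorem within_zero {α : Ordinal.{u}} {σ : ℕ → Ordinal.{u}} : Within α 0 σ ↔ ∀ i, σ i < α :=
  ⟨fun h => h.2, fun h => ⟨fun _ => zero_le, h⟩⟩

theorem within_zero_st {α a x p q t T d : Ordinal.{u}} {r v : ℕ → Ordinal.{u}} :
    Within α 0 (st a x p q t T d r v) ↔ a < α ∧ x < α ∧ p < α ∧ q < α ∧ t < α ∧ T < α ∧ d < α ∧
      (∀ j, r j < α) ∧ ∀ j, v j < α := by
  simp [within_st_iff]

theorem init_pair (a x : Ordinal.{u}) :
    RegConfig.init [a, x] = ⟨0, st a x 0 0 0 0 0 0 0⟩ := by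
  refine RegConfig.ext rfl ?_
  rw [eq_st_iff]
  simp [RegConfig.init, sim, par]

theorem init_single (a : Ordinal.{u}) : RegConfig.init [a] = ⟨0, st a 0 0 0 0 0 0 0 0⟩ := by
  refine RegConfig.ext rfl ?_
  rw [eq_st_iff]
  simp [RegConfig.init, sim, par]

/-! ### Coding pairs of ordinals -/

/-- The position of the pair `(i, M)`, `i ≤ M`, in the enumeration of such pairs in which `M`
grows as slowly as possible. -/
noncomputable def pairCode (i M : Ordinal.{u}) : Ordinal.{u} := osum (fun m => m + 1) M + i

theorem exists_pairCode (ι : Ordinal.{u}) : ∃ y : Ordinal.{u} × Ordinal.{u}, y.1 ≤ y.2 ∧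
    pairCode y.1 y.2 = ι := by
  have h : ι < osum (fun m => m + 1) (ι + 1) :=
    (lt_add_one ι).trans_le (le_osum fun _ _ => by simp)
  obtain ⟨κ, -, h1, h2⟩ := exists_osum_le_lt _ h
  obtain ⟨i, rfl⟩ := le_iff_exists_add.1 h1
  rw [osum_add_one] at h2
  exact ⟨(i, κ), Order.lt_add_one_iff.1 (lt_of_add_lt_add_left h2), rfl⟩

/-- The pair with a given position. -/
noncomputable def pairOf (ι : Ordinal.{u}) : Ordinal.{u} × Ordinal.{u} := (exists_pairCode ι).choose

theorem pairOf_le (ι : Ordinal.{u}) : (pairOf ι).1 ≤ (pairOf ι).2 :=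
  (exists_pairCode ι).choose_spec.1

theorem pairCode_pairOf (ι : Ordinal.{u}) : pairCode (pairOf ι).1 (pairOf ι).2 = ι :=
  (exists_pairCode ι).choose_spec.2

theorem pairCode_lt_osum {i M N : Ordinal.{u}} (hi : i ≤ M) (h : M < N) :
    pairCode i M < osum (fun m => m + 1) N := by
  refine lt_of_lt_of_le ?_ (osum_mono _ (Order.add_one_le_of_lt h))
  rw [osum_add_one]
  exact (add_lt_add_iff_left _).2 (Order.lt_add_one_iff.2 hi)

theorem le_pairOf_snd {ι M : Ordinal.{u}} (h : osum (fun m => m + 1) M ≤ ι) : M ≤ (pairOf ι).2 := by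
  by_contra! hlt
  have := pairCode_lt_osum (pairOf_le ι) hlt
  rw [pairCode_pairOf] at this
  exact absurd this h.not_gt

theorem pairOf_pairCode {i M : Ordinal.{u}} (hi : i ≤ M) : pairOf (pairCode i M) = (i, M) := by
  have h1 : M ≤ (pairOf (pairCode i M)).2 := le_pairOf_snd le_self_add
  have h2 := pairCode_pairOf (pairCode i M)
  rcases h1.eq_or_lt with h3 | h3
  · rw [← h3] at h2
    exact Prod.ext (add_left_cancel h2) h3.symm
  · have h4 := pairCode_lt_osum hi h3
    exact absurd (le_self_add.trans h2.le) h4.not_ge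

theorem pairOf_snd_mono {s t : Ordinal.{u}} (h : s ≤ t) : (pairOf s).2 ≤ (pairOf t).2 :=
  le_pairOf_snd ((le_self_add.trans (pairCode_pairOf s).le).trans h)

theorem pairOf_snd_le (ι : Ordinal.{u}) : (pairOf ι).2 ≤ ι :=
  (le_osum (γ := fun m => m + 1) fun _ _ => by simp).trans
    (le_self_add.trans (pairCode_pairOf ι).le)

theorem pairOf_zero : pairOf (0 : Ordinal.{u}) = (0, 0) := by
  have := pairOf_pairCode (le_refl (0 : Ordinal.{u}))
  rwa [pairCode, osum_zero, add_zero] at this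

theorem pairOf_add_one_of_eq {ι : Ordinal.{u}} (h : (pairOf ι).1 = (pairOf ι).2) :
    pairOf (ι + 1) = (0, (pairOf ι).2 + 1) := by
  have h1 := pairCode_pairOf ι
  rw [h, pairCode] at h1
  have h2 : pairCode 0 ((pairOf ι).2 + 1) = ι + 1 := by
    rw [pairCode, osum_add_one, add_zero, ← add_assoc, h1]
  rw [← h2, pairOf_pairCode zero_le]

theorem pairOf_add_one_of_ne {ι : Ordinal.{u}} (h : (pairOf ι).1 ≠ (pairOf ι).2) :
    pairOf (ι + 1) = ((pairOf ι).1 + 1, (pairOf ι).2) := by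
  have h1 := pairCode_pairOf ι
  rw [pairCode] at h1
  have h2 : pairCode ((pairOf ι).1 + 1) (pairOf ι).2 = ι + 1 := by
    rw [pairCode, ← add_assoc, h1]
  conv_lhs => rw [← h2]
  exact pairOf_pairCode (Order.add_one_le_of_lt ((pairOf_le ι).lt_of_ne h))

/-- This makes the enumeration of pairs run correctly through limits. At the start of block `M`, for
`M` a limit, the first component has been reset to `0` cofinally often; inside a block it is
continuous. -/
theorem isLiminf_pairOf {l : Ordinal.{u}} (hl : Order.IsSuccLimit l) :
    IsLiminf (fun ι => (pairOf ι).1) l (pairOf l).1 ∧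
      IsLiminf (fun ι => (pairOf ι).2) l (pairOf l).2 := by
  obtain ⟨⟨i, M⟩, hi, rfl⟩ := exists_pairCode l
  simp only at hi hl ⊢
  rw [pairOf_pairCode hi]
  rcases Ordinal.zero_or_succ_or_isSuccLimit i with rfl | ⟨j, rfl⟩ | hi'
  · rcases Ordinal.zero_or_succ_or_isSuccLimit M with rfl | ⟨N, rfl⟩ | hM
    · rw [pairCode, osum_zero, add_zero] at hl
      exact absurd hl Ordinal.not_isSuccLimit_zero
    -- A block has length `N + 1` because `i = M` is allowed, so the next block starts at a
    -- successor position and no limit falls there.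
    · rw [pairCode, Order.succ_eq_add_one N, osum_add_one, add_zero, ← add_assoc,
        ← Order.succ_eq_add_one] at hl
      exact absurd hl.isSuccPrelimit (Order.not_isSuccPrelimit_succ _)
    · rw [pairCode, add_zero] at hl ⊢
      have hcof : ∀ s < osum (fun m => m + 1) M, ∃ N < M, s ≤ osum (fun m => m + 1) N :=
        fun s hs => let ⟨N, h1, h2⟩ := (lt_osum_limit _ hM).1 hs; ⟨N, h1, h2.le⟩
      have hval : ∀ N : Ordinal.{u}, pairOf (osum (fun m => m + 1) N) = (0, N) := fun N => by
        have := pairOf_pairCode (zero_le (a := N))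
        rwa [pairCode, add_zero] at this
      have hlt : ∀ N < M, osum (fun m => m + 1) N < osum (fun m => m + 1) M := fun N hN =>
        osum_lt_osum hN (by simp)
      refine ⟨⟨fun w hw => absurd hw (by simp), fun s hs => ?_⟩, fun w hw => ?_, fun s hs => ?_⟩
      · obtain ⟨N, hN, h1⟩ := hcof s hs
        exact ⟨_, h1, hlt N hN, by simp [hval]⟩
      · refine ⟨_, hlt _ (hM.add_one_lt hw), fun t h1 _ => ?_⟩
        exact (lt_add_one w).trans_le (le_pairOf_snd h1)
      · obtain ⟨N, hN, h1⟩ := hcof s hs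
        exact ⟨_, h1, hlt N hN, by simpa [hval] using hN.le⟩
  · rw [pairCode, Order.succ_eq_add_one, ← add_assoc, ← Order.succ_eq_add_one] at hl
    exact absurd hl.isSuccPrelimit (Order.not_isSuccPrelimit_succ _)
  · unfold pairCode
    have h : ∀ t < i, pairOf (osum (fun m => m + 1) M + t) = (t, M) := fun t ht =>
      pairOf_pairCode (ht.le.trans hi)
    rw [IsLiminf.shift_iff _ hi', IsLiminf.shift_iff _ hi']
    exact ⟨(IsLiminf.id hi').congr fun t ht => by rw [h t ht],
      (IsLiminf.const hi'.bot_lt M).congr fun t ht => by rw [h t ht]⟩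

/-- One step in the enumeration of pairs. -/
def enumStmt : Stmt := .ite (.eq 4 5) (.succ 5 ;; .zero 4) (.succ 4)

section enum

variable {α : Ordinal.{u}} {a x p q T d : Ordinal.{u}} {r v : ℕ → Ordinal.{u}}

theorem runs_enumStmt {m : ℕ → Ordinal.{u}} {ι : Ordinal.{u}}
    (hw : Within α m (st a x p q (pairOf ι).1 (pairOf ι).2 d r v))
    (hw' : Within α m (st a x p q (pairOf (ι + 1)).1 (pairOf (ι + 1)).2 d r v)) :
    Runs α m enumStmt (st a x p q (pairOf ι).1 (pairOf ι).2 d r v)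
      (st a x p q (pairOf (ι + 1)).1 (pairOf (ι + 1)).2 d r v) := by
  have hw2 : Within α m (st a x p q (pairOf ι).1 (pairOf (ι + 1)).2 d r v) := by
    rw [within_st_iff] at hw hw' ⊢
    tauto
  by_cases h : (pairOf ι).1 = (pairOf ι).2
  · rw [pairOf_add_one_of_eq h] at hw' hw2 ⊢
    refine .ite_true hw h (.succ_seq hw ?_)
    simpa using Runs.zero (i := 4) (hw2)
  · rw [pairOf_add_one_of_ne h] at hw' ⊢
    refine .ite_false hw h ?_ hw'
    simpa using Runs.succ (i := 4) hw

/-- The extra body `s` changes only register 6. It is empty when the enumeration serves as a clock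
and increments register 6 when positions are to be computed. -/
theorem exists_exec_enum {b : JumpCond} {s : Stmt} {D : Ordinal.{u} → Ordinal.{u}}
    {β : Ordinal.{u}}
    (hb : ∀ ι < β, b.Holds (st a x p q (pairOf ι).1 (pairOf ι).2 (D ι) r v))
    (hβ : ¬ b.Holds (st a x p q (pairOf β).1 (pairOf β).2 (D β) r v))
    (hw : ∀ ι ≤ β, Within α 0 (st a x p q (pairOf ι).1 (pairOf ι).2 (D ι) r v))
    (hs : ∀ ι < β, ∀ m t T, Within α m (st a x p q t T (D ι) r v) →
      Runs α m s (st a x p q t T (D ι) r v) (st a x p q t T (D (ι + 1)) r v))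
    (hD : ∀ l ≤ β, Order.IsSuccLimit l → IsLiminf D l (D l)) :
    ∃ γ, β < γ ∧ Exec α 0 (.loop b (enumStmt ;; s)) (st a x p q 0 0 (D 0) r v) γ
      (st a x p q (pairOf β).1 (pairOf β).2 (D β) r v) := by
  have key := exists_exec_loop (α := α) (m := 0) (b := b) (β := β)
    (s := enumStmt ;; s) (τ := 0)
    (σ := fun ι => st a x p q (pairOf ι).1 (pairOf ι).2 (D ι) r v) hb hβ hw
    (fun ι hι => ?_) (fun l hl hlim => ?_)
  · obtain ⟨γ, hγ, -, h⟩ := key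
    exact ⟨γ, hγ, by simpa [pairOf_zero] using h⟩
  · have hι' := Order.add_one_le_of_lt hι
    generalize hm : st a x p q (pairOf ι).1 (pairOf ι).2 (D ι) r v ⊓
      st a x p q (pairOf (ι + 1)).1 (pairOf (ι + 1)).2 (D (ι + 1)) r v = m
    have w0 : Within α m (st a x p q (pairOf ι).1 (pairOf ι).2 (D ι) r v) :=
      ⟨hm ▸ inf_le_left, (hw ι hι.le).2⟩
    have w1 : Within α m (st a x p q (pairOf (ι + 1)).1 (pairOf (ι + 1)).2 (D (ι + 1)) r v) :=
      ⟨hm ▸ inf_le_right, (hw _ hι').2⟩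
    have w2 : Within α m (st a x p q (pairOf (ι + 1)).1 (pairOf (ι + 1)).2 (D ι) r v) := by
      rw [within_st_iff] at w0 w1 ⊢
      tauto
    obtain ⟨γ, hγ⟩ := (runs_enumStmt w0 w2).seq (hs ι hι m _ _ w2)
    exact ⟨γ, zero_le, hγ⟩
  · have hl0 := hlim.bot_lt
    have hp := isLiminf_pairOf hlim
    exact isLiminf_st (.const hl0 _) (.const hl0 _) (.const hl0 _) (.const hl0 _) hp.1 hp.2
      (hD l hl hlim) (fun _ => .const hl0 _) fun _ => .const hl0 _

/-- Enumeration of pairs, with a counter. -/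
theorem runs_enum_count {b : JumpCond} {β : Ordinal.{u}}
    (hb : ∀ ι < β, b.Holds (st a x p q (pairOf ι).1 (pairOf ι).2 ι r v))
    (hβ : ¬ b.Holds (st a x p q (pairOf β).1 (pairOf β).2 β r v)) (hβα : β < α)
    (hw : Within α 0 (st a x p q 0 0 0 r v)) :
    Runs α 0 (.loop b (enumStmt ;; .succ 6)) (st a x p q 0 0 0 r v)
      (st a x p q (pairOf β).1 (pairOf β).2 β r v) := by
  have key := exists_exec_enum (α := α) (D := fun ι => ι) (s := .succ 6) hb hβ
    (fun ι hι => ?_) (fun ι hι m t T h => by simpa using Runs.succ h 6) fun l _ hl => .id hl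
  · exact key.imp fun γ h => h.2
  · rw [within_zero_st] at hw ⊢
    have h2 := ((pairOf_snd_le ι).trans hι).trans_lt hβα
    exact ⟨hw.1, hw.2.1, hw.2.2.1, hw.2.2.2.1, (pairOf_le ι).trans_lt h2, h2, hι.trans_lt hβα,
      hw.2.2.2.2.2.2.2⟩

/-! ### Closure under pair coding, from weakness and from regularity -/

/-- `α` is closed under the coding of pairs. -/
def PairClosed (α : Ordinal.{u}) : Prop := ∀ M < α, pairCode M M < α

/-- Enumerating pairs up to `(M, M)` takes more than `pairCode M M` steps, while the registers hold
only ordinals `≤ M`. The position itself is not counted, as it is not yet known to be below `α`. -/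
theorem PairClosed.of_isUWeak (hα : Ordinal.omega0 < α) (h : IsUWeak α) : PairClosed α := by
  intro M hM
  have h0 : (0 : Ordinal.{u}) < α := Ordinal.omega0_pos.trans hα
  have hle : ∀ ι ≤ pairCode M M, (pairOf ι).2 < α := fun ι hι => by
    have := pairOf_snd_mono hι
    rw [pairOf_pairCode le_rfl] at this
    exact this.trans_lt hM
  have key := exists_exec_enum (α := α) (a := M) (x := 0) (p := 0) (q := 0) (r := 0)
    (v := 0) (b := .not (.and (.eq 4 5) (.eq 5 0))) (D := fun _ => 0) (s := .skip)
    (β := pairCode M M) (fun ι hι => ?_) ?_ (fun ι hι => ?_) (fun _ _ _ _ _ _ => .skip)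
    fun l _ hl => .const hl.bot_lt _
  · obtain ⟨γ, hγ, hex⟩ := key
    refine hγ.trans (h γ ⟨_, M, hM, _, init_single M ▸ hex.haltsIn ?_⟩)
    rw [← within_zero, within_zero_st]
    have := hle _ le_rfl
    exact ⟨hM, h0, h0, h0, (pairOf_le _).trans_lt this, this, h0, fun _ => h0, fun _ => h0⟩
  · simp only [JumpCond.Holds, st_zero, st_four, st_five]
    rintro ⟨h1, h2⟩
    have h3 := pairCode_pairOf ι
    rw [h1, h2] at h3
    exact hι.ne h3.symm
  · simp [JumpCond.Holds, pairOf_pairCode le_rfl]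
  · have := hle _ hι
    exact within_zero_st.2
      ⟨hM, h0, h0, h0, (pairOf_le _).trans_lt this, this, h0, fun _ => h0, fun _ => h0⟩

/-- At a least failure `M`, positions of pairs below the failure are computable and give a cofinal
map, either along the diagonal or inside the block `M`. -/
theorem PairClosed.of_isWITRMRegular (hα : Ordinal.omega0 < α) (h : IsWITRMRegular α) :
    PairClosed α := by
  have h0 : (0 : Ordinal.{u}) < α := Ordinal.omega0_pos.trans hα
  -- Enumerate pairs with a counter until `b` fails, and output the position reached.
  have key : ∀ b : JumpCond, ∀ a ξ β : Ordinal.{u}, a < α → ξ < α → β < α →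
      (∀ ι < β, b.Holds (st a ξ 0 0 (pairOf ι).1 (pairOf ι).2 ι 0 0)) →
      ¬ b.Holds (st a ξ 0 0 (pairOf β).1 (pairOf β).2 β 0 0) →
      ∃ γ d, HaltsIn α ((Stmt.loop b (enumStmt ;; .succ 6) ;; .copy 6 0).code 0)
        (RegConfig.init [a, ξ]) γ d ∧ d.reg 0 = β := by
    intro b a ξ β ha hξ hβ h1 h2
    have hp := (pairOf_snd_le β).trans_lt hβ
    have hw : Within α 0 (st a ξ 0 0 (pairOf β).1 (pairOf β).2 β 0 0) := within_zero_st.2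
      ⟨ha, hξ, h0, h0, (pairOf_le _).trans_lt hp, hp, hβ, fun _ => h0, fun _ => h0⟩
    have hr := runs_enum_count h1 h2 hβ
      (within_zero_st.2 ⟨ha, hξ, h0, h0, h0, h0, h0, fun _ => h0, fun _ => h0⟩)
    obtain ⟨γ, hγ⟩ := hr.seq (Runs.copy hw 6 0)
    refine ⟨γ, _, init_pair a ξ ▸ hγ.haltsIn ?_, by simp⟩
    rw [← within_zero]
    simp only [update_st_zero, st_six, within_zero_st] at hw ⊢
    exact ⟨hβ, hw.2⟩
  intro M
  induction M using WellFoundedLT.induction with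
  | ind M ih =>
  intro hM
  by_contra! hα'
  refine h ?_
  -- If the blocks before `M` already exhaust `α`, the map `m ↦ pairCode m m` on `M` is cofinal, as
  -- `pairCode m m + 1` is the end of block `m`. Otherwise `α` is reached inside block `M`, at a
  -- least `i`, and `j ↦ pairCode j M` on `i` is cofinal.
  rcases le_or_gt α (osum (fun m => m + 1) M) with h1 | h1
  · have ih' : ∀ m : Set.Iio M, pairCode m.1 m.1 < α := fun m => ih m m.2 (m.2.trans hM)
    refine ⟨M, hM, fun m => ⟨pairCode m.1 m.1, ih' m⟩, fun y => ?_,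
      _, 0, h0, fun m => key (.not (.and (.eq 4 5) (.eq 5 0))) _ _ _ (m.2.trans hM) h0 (ih' m)
        (fun ι hι => ?_) ?_⟩
    · obtain ⟨κ, hκ, -, h2⟩ := exists_osum_le_lt _ (y.2.trans_le h1)
      refine ⟨_, ⟨⟨κ, hκ⟩, rfl⟩, ?_⟩
      rw [osum_add_one, ← add_assoc] at h2
      exact Subtype.coe_le_coe.1 (Order.lt_add_one_iff.1 h2)
    · simp only [JumpCond.Holds, st_zero, st_four, st_five]
      rintro ⟨h1, h2⟩
      have h3 := pairCode_pairOf ι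
      rw [h1, h2] at h3
      exact hι.ne h3.symm
    · simp [JumpCond.Holds, pairOf_pairCode le_rfl]
  · have hex : ∃ i, i ≤ M ∧ α ≤ pairCode i M := ⟨M, le_rfl, hα'⟩
    obtain ⟨i, ⟨hiM, hi⟩, hmin⟩ := WellFounded.has_min wellFounded_lt
      {i | i ≤ M ∧ α ≤ pairCode i M} hex
    have hlt : ∀ j : Set.Iio i, pairCode j.1 M < α := fun j => by
      by_contra! hj
      exact hmin _ ⟨j.2.le.trans hiM, hj⟩ j.2
    have hi0 : i ≠ 0 := by
      rintro rfl
      rw [pairCode, add_zero] at hi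
      exact h1.not_ge hi
    refine ⟨i, hiM.trans_lt hM, fun j => ⟨pairCode j.1 M, hlt j⟩, fun y => ?_,
      _, M, hM, fun j => key (.not (.and (.eq 4 0) (.eq 5 1))) _ _ _ (j.2.trans (hiM.trans_lt hM))
        hM (hlt j) (fun ι hι => ?_) ?_⟩
    · obtain ⟨j, hj, h2⟩ := (Ordinal.lt_add_iff hi0).1 (y.2.trans_le hi)
      exact ⟨_, ⟨⟨j, hj⟩, rfl⟩, h2⟩
    · simp only [JumpCond.Holds, st_zero, st_one, st_four, st_five]
      rintro ⟨h1, h2⟩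
      have h3 := pairCode_pairOf ι
      rw [h1, h2] at h3
      exact hι.ne h3.symm
    · simp [JumpCond.Holds, pairOf_pairCode (j.2.le.trans hiM)]

theorem PairClosed.isSuccLimit (hα : Ordinal.omega0 < α) (h : PairClosed α) :
    Order.IsSuccLimit α := by
  refine Ordinal.isSuccLimit_iff.2 ⟨(Ordinal.omega0_pos.trans hα).ne', ?_⟩
  refine Order.isSuccPrelimit_of_succ_lt fun a ha => ?_
  rcases eq_or_ne a 0 with rfl | ha0
  · rw [Order.succ_eq_add_one, zero_add]
    exact Ordinal.one_lt_omega0.trans hα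
  · refine lt_of_le_of_lt ?_ (h a ha)
    rw [Order.succ_eq_add_one]
    exact add_le_add (le_osum fun _ _ => by simp) (Order.one_le_iff_pos.2 (bot_lt_iff_ne_bot.2 ha0))

/-- Finitely many ordinals `< α` are coded by a single one. -/
theorem exists_load (hcl : PairClosed α) (h0 : 0 < α) {w : ℕ → Ordinal.{u}} (hw : ∀ j, w j < α)
    (K : ℕ) : ∃ ξ < α, ∃ s, ∀ a v, a < α → (∀ j, v j < α) →
      Runs α 0 s (st a ξ 0 0 0 0 0 0 v)
        (st a 0 0 0 0 0 0 0 fun j => if j < K then w j else v j) := by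
  induction K with
  | zero => exact ⟨0, h0, .skip, fun a v _ _ => by simpa using Runs.skip⟩
  | succ K ih =>
    obtain ⟨ξ, hξ, s, hs⟩ := ih
    -- `w K` and the code `ξ` of the earlier values are paired in increasing order; `k` and `k'` are
    -- whichever of the registers 4 and 5 receive them on decoding.
    have hmain : ∀ i M : Ordinal.{u}, i ≤ M → M < α → ∀ k k' : ℕ, (∀ a x p q d r v,
        st a x p q i M d r v k = w K ∧ st a x p q i M d r v k' = ξ) → ∃ ξ < α, ∃ s, ∀ a v, a < α →
        (∀ j, v j < α) → Runs α 0 s (st a ξ 0 0 0 0 0 0 v)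
          (st a 0 0 0 0 0 0 0 fun j => if j < K + 1 then w j else v j) := by
      intro i M hi hM k k' hk
      have hξ' : pairCode i M < α := lt_of_le_of_lt (by unfold pairCode; gcongr) (hcl M hM)
      refine ⟨pairCode i M, hξ', .loop (.not (.eq 6 1)) (enumStmt ;; .succ 6) ;; .copy k (par K) ;;
        .copy k' 1 ;; .zero 4 ;; .zero 5 ;; .zero 6 ;; s, fun a v ha hv => ?_⟩
      have hv' : ∀ j, Function.update v K (w K) j < α := fun j => by
        rw [Function.update_apply]
        split
        exacts [hw K, hv j]
      refine (runs_enum_count (fun ι hι => ?_) ?_ hξ' ?_).seq ?_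
      · simpa [JumpCond.Holds] using hι.ne
      · simp [JumpCond.Holds]
      · exact within_zero_st.2 ⟨ha, hξ', h0, h0, h0, h0, h0, fun _ => h0, hv⟩
      rw [pairOf_pairCode hi]
      have hi' := hi.trans_lt hM
      refine .copy_seq (within_zero_st.2 ⟨ha, hξ', h0, h0, hi', hM, hξ', fun _ => h0, hv⟩) ?_
      rw [(hk ..).1, update_st_par]
      refine .copy_seq (within_zero_st.2 ⟨ha, hξ', h0, h0, hi', hM, hξ', fun _ => h0, hv'⟩) ?_
      rw [(hk ..).2, update_st_one]
      refine .zero_seq (within_zero_st.2 ⟨ha, hξ, h0, h0, hi', hM, hξ', fun _ => h0, hv'⟩) ?_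
      rw [update_st_four]
      refine .zero_seq (within_zero_st.2 ⟨ha, hξ, h0, h0, h0, hM, hξ', fun _ => h0, hv'⟩) ?_
      rw [update_st_five]
      refine .zero_seq (within_zero_st.2 ⟨ha, hξ, h0, h0, h0, h0, hξ', fun _ => h0, hv'⟩) ?_
      rw [update_st_six]
      convert hs a _ ha hv' using 2
      funext j
      rcases lt_trichotomy j K with h | rfl | h
      · simp [h, h.trans (Nat.lt_succ_self K)]
      · simp
      · simp [h.not_gt, h.ne', show ¬ j < K + 1 by omega]
    -- The decoding program may depend on which of the two is smaller.
    rcases le_total (w K) ξ with h | h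
    · exact hmain (w K) ξ h hξ 4 5 fun _ _ _ _ _ _ _ => ⟨rfl, rfl⟩
    · exact hmain ξ (w K) h (hw K) 5 4 fun _ _ _ _ _ _ _ => ⟨rfl, rfl⟩

end enum

/-! ### Registers that a program does not change -/

/-- A strict bound on the register that an instruction changes. -/
def RegInstr.dest : RegInstr → ℕ
  | .zero i => i + 1
  | .succ i => i + 1
  | .copy _ j => j + 1
  | .jump _ _ => 0

/-- A strict bound on the registers that `P` changes. -/
def regBound (P : RegProgram) : ℕ := (P.map RegInstr.dest).sum

theorem step_reg_of_le {P : RegProgram} (c : RegConfig.{u}) {j : ℕ} (hj : regBound P ≤ j) :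
    (c.step P).reg j = c.reg j := by
  unfold RegConfig.step
  split
  · rename_i I hI
    have h : I.dest ≤ (P.map RegInstr.dest).sum :=
      List.single_le_sum (by simp) _ (List.mem_map_of_mem (List.mem_of_getElem? hI))
    unfold regBound at hj
    cases I with
    | jump b l => rfl
    | _ =>
      simp only [RegInstr.dest] at h
      exact Function.update_of_ne (by omega) _ _
  · rfl

theorem comp_reg_of_le {P : RegProgram} (c : RegConfig.{u}) {j : ℕ} (hj : regBound P ≤ j)
    (t : Ordinal.{u}) : (comp P c t).reg j = c.reg j := by
  induction t using Ordinal.limitRecOn with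
  | zero => rw [comp_zero]
  | add_one t ih => rw [comp_add_one, step_reg_of_le _ hj, ih]
  | limit l hl ih =>
    exact ((isLiminfConfig_comp P c hl).2 j).unique
      ((IsLiminf.const hl.bot_lt _).congr fun t ht => (ih t ht).symm)

theorem init_single_reg (ζ : Ordinal.{u}) :
    (RegConfig.init [ζ]).reg = Function.update (0 : ℕ → Ordinal.{u}) 0 ζ := by
  funext i
  rcases i with _ | i <;> simp [RegConfig.init]

theorem init_pair_reg (ι ξ : Ordinal.{u}) :
    (RegConfig.init [ι, ξ]).reg =
      Function.update (Function.update (0 : ℕ → Ordinal.{u}) 0 ι) 1 ξ := by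
  funext i
  rcases i with _ | _ | i <;> simp [RegConfig.init]

/-- Clear the first `n` simulated registers. -/
def clearStmt : ℕ → Stmt
  | 0 => .skip
  | n + 1 => clearStmt n ;; .zero (sim n)

section

variable {α : Ordinal.{u}} {m : ℕ → Ordinal.{u}} {a x p q t T d : Ordinal.{u}}
  {r v : ℕ → Ordinal.{u}}

theorem Within.st_sim (h : Within α m (st a x p q t T d 0 v)) (hr : ∀ j, r j < α) :
    Within α m (st a x p q t T d r v) := by
  rw [within_st_iff] at h ⊢
  obtain ⟨h1, h2, h3, h4, h5, h6, h7, h8, h9⟩ := h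
  exact ⟨h1, h2, h3, h4, h5, h6, h7, fun j => ⟨(h8 j).1.trans zero_le, hr j⟩, h9⟩

theorem runs_clearStmt (hw : Within α m (st a x p q t T d 0 v)) (hr : ∀ j, r j < α) {n : ℕ}
    (hn : ∀ j, n ≤ j → r j = 0) :
    Runs α m (clearStmt n) (st a x p q t T d r v) (st a x p q t T d 0 v) := by
  have key : ∀ k, Runs α m (clearStmt k) (st a x p q t T d r v)
      (st a x p q t T d (fun j => if j < k then 0 else r j) v) := by
    intro k
    induction k with
    | zero => simpa [clearStmt] using (Runs.skip (α := α) (m := m) (σ := st a x p q t T d r v))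
    | succ k ih =>
      refine ih.seq ?_
      have h := Runs.zero (hw.st_sim (r := fun j => if j < k then 0 else r j) fun j => by
        split
        exacts [(hr j).bot_lt, hr j]) (sim k)
      rw [update_st_sim] at h
      convert h using 2
      funext j
      rcases lt_trichotomy j k with h | rfl | h
      · simp [h, h.ne, h.trans (Nat.lt_succ_self k)]
      · simp
      · simp [h.not_gt, h.ne', show ¬ j < k + 1 by omega]
  convert key n using 2
  funext j
  by_cases h : j < n
  · simp [h]
  · simp [h, hn j (not_lt.1 h)]

/-- Turns an output into running time: counting up to `r 0` takes more than `r 0` steps. -/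
theorem exists_exec_count (hw : Within α m (st a x p q 0 T d r v)) :
    ∃ γ, r 0 < γ ∧ Exec α m (.loop (.not (.eq 4 (sim 0))) (.succ 4)) (st a x p q 0 T d r v) γ
      (st a x p q (r 0) T d r v) := by
  have key := exists_exec_loop (α := α) (m := m) (b := .not (.eq 4 (sim 0))) (s := .succ 4)
    (σ := fun ι => st a x p q ι T d r v) (β := r 0) (τ := 0) (fun ι hι => ?_) ?_ (fun ι hι => ?_)
    (fun ι hι => ?_) fun l _ hl => ?_
  · obtain ⟨γ, h1, -, h2⟩ := key
    exact ⟨γ, h1, h2⟩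
  · simpa [JumpCond.Holds] using hι.ne
  · simp [JumpCond.Holds]
  · rw [within_st_iff] at hw ⊢
    obtain ⟨h1, h2, h3, h4, h5, h6, h7, h8, h9⟩ := hw
    exact ⟨h1, h2, h3, h4, ⟨h5.1.trans zero_le, hι.trans_lt (h8 0).2⟩, h6, h7, h8, h9⟩
  · refine ⟨1, zero_le, ?_⟩
    have h : Within α (st a x p q ι T d r v ⊓ st a x p q (ι + 1) T d r v)
        (st a x p q ι T d r v) := by
      refine ⟨inf_le_left, ?_⟩
      rw [← within_zero, within_zero_st]
      rw [within_st_iff] at hw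
      obtain ⟨h1, h2, h3, h4, h5, h6, h7, h8, h9⟩ := hw
      exact ⟨h1.2, h2.2, h3.2, h4.2, hι.trans (h8 0).2, h6.2, h7.2, fun j => (h8 j).2,
        fun j => (h9 j).2⟩
    simpa using Exec.succ h 4
  · have hl0 := hl.bot_lt
    exact isLiminf_st (.const hl0 _) (.const hl0 _) (.const hl0 _) (.const hl0 _) (.id hl)
      (.const hl0 _) (.const hl0 _) (fun _ => .const hl0 _) fun _ => .const hl0 _

end

/-! ### Weakness implies regularity -/

section

variable {α : Ordinal.{u}}

/-- Run `P` on the inputs in the registers `0` and `par 1`. -/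
def callStmt (P : RegProgram) : Stmt :=
  .copy 0 (sim 0) ;; .copy (par 1) (sim 1) ;; constStmt 3 P.length ;; .copy 3 5 ;; .zero 3 ;;
    simLoop P (.not (.eq 2 5)) (.eq 0 0)

/-- Run `P` on the inputs in the registers `0` and `par 1`, take as many further steps as the
output says, clean up and go to the next input. -/
def tallyStmt (P : RegProgram) (n : ℕ) : Stmt :=
  callStmt P ;; .loop (.not (.eq 4 (sim 0))) (.succ 4) ;;
    clearStmt n ;; .zero 2 ;; .zero 4 ;; .zero 5 ;; .succ 0

/-- One pass of the outer loop over the inputs. All working registers are `0` at both ends, so only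
the input counter and the parameters are bounded from below; hence they must not decrease during the
pass. -/
theorem exists_exec_tallyStmt (hα : Ordinal.omega0 < α) {P : RegProgram} {n : ℕ}
    (hn : regBound P ≤ n) (hn2 : 2 ≤ n) {ι : Ordinal.{u}} {v : ℕ → Ordinal.{u}} (hι : ι < α)
    (hv : ∀ j, v j < α) {γ : Ordinal.{u}} {c : RegConfig.{u}}
    (h : HaltsIn α P (RegConfig.init [ι, v 1]) γ c) :
    ∃ δ, c.reg 0 ≤ δ ∧ Exec α (st ι 0 0 0 0 0 0 0 v) (tallyStmt P n) (st ι 0 0 0 0 0 0 0 v) δ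
      (st (ι + 1) 0 0 0 0 0 0 0 v) := by
  obtain ⟨hreg, hrun, rfl, hhalt⟩ := haltsIn_iff.1 h
  set c := RegConfig.init [ι, v 1] with hc
  have h0 : (0 : Ordinal.{u}) < α := Ordinal.omega0_pos.trans hα
  have hlen := natCast_lt_of_omega0_lt hα
  have hW : ∀ {p q t T : Ordinal.{u}} {r : ℕ → Ordinal.{u}}, p < α → q < α → t < α → T < α →
      (∀ j, r j < α) → Within α (st ι 0 0 0 0 0 0 0 v) (st ι 0 p q t T 0 r v) :=
    fun hp hq ht hT hr => by simp [within_st_iff, *]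
  have hr0 : ∀ j, (0 : ℕ → Ordinal.{u}) j < α := fun _ => h0
  have hr1 : ∀ j, Function.update (0 : ℕ → Ordinal.{u}) 0 ι j < α := fun j => by
    rw [Function.update_apply]; split
    exacts [hι, h0]
  have hr2 : ∀ j, c.reg j < α := fun j => by simpa [comp_zero] using hreg 0 zero_le j
  have hrγ := hreg γ le_rfl
  have hpre : Runs α (st ι 0 0 0 0 0 0 0 v) (callStmt P) (st ι 0 0 0 0 0 0 0 v)
      (st ι 0 (min (comp P c γ).line P.length : ℕ) 0 0 P.length 0 (comp P c γ).reg v) := by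
    refine .copy_seq (hW h0 h0 h0 h0 hr0) ?_
    rw [update_st_sim, st_zero]
    refine .copy_seq (hW h0 h0 h0 h0 hr1) ?_
    rw [update_st_sim, st_par, ← init_pair_reg]
    refine (runs_constStmt hα (hW h0 h0 h0 h0 hr2) h0 _).seq ?_
    refine .copy_seq (hW h0 (hlen _) h0 h0 hr2) ?_
    rw [update_st_five, st_three]
    refine .zero_seq (hW h0 (hlen _) h0 (hlen _) hr2) ?_
    rw [update_st_three]
    have key := runs_simLoop (α := α) (m := st ι 0 0 0 0 0 0 0 v) (a := ι) (x := 0)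
      (T := P.length) (d := 0) (v := v) (c := c) (β := γ) (e := fun _ => 0)
      (b := .not (.eq 2 5)) (h := .eq 0 0) hα (fun t ht => ?_) ?_ (fun _ _ => .inl ⟨rfl, rfl⟩)
      (fun l _ hl => .const hl.bot_lt _) (fun t ht => hW (hlen _) h0 h0 (hlen _) (hreg t ht)) hrun
    · simpa [hc, RegConfig.init] using key
    · have := not_le.1 (hrun t ht)
      simpa only [JumpCond.Holds, st_two, st_five, Nat.cast_inj] using
        ((min_le_left _ _).trans_lt this).ne
    · simpa [JumpCond.Holds, RegConfig.IsHalted] using hhalt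
  obtain ⟨δ₁, h1⟩ := hpre
  obtain ⟨δ₂, hδ, h2⟩ := exists_exec_count (m := st ι 0 0 0 0 0 0 0 v) (a := ι) (x := 0)
    (p := (min (comp P c γ).line P.length : ℕ)) (q := 0) (T := P.length) (d := 0)
    (r := (comp P c γ).reg) (v := v) (hW (hlen _) h0 h0 (hlen _) hrγ)
  have hpost : Runs α (st ι 0 0 0 0 0 0 0 v)
      (clearStmt n ;; .zero 2 ;; .zero 4 ;; .zero 5 ;; .succ 0)
      (st ι 0 (min (comp P c γ).line P.length : ℕ) 0 ((comp P c γ).reg 0) P.length 0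
        (comp P c γ).reg v) (st (ι + 1) 0 0 0 0 0 0 0 v) := by
    refine (runs_clearStmt (hW (hlen _) h0 (hrγ 0) (hlen _) hr0) hrγ fun j hj => ?_).seq ?_
    · rw [comp_reg_of_le c (hn.trans hj), hc, init_pair_reg]
      rw [Function.update_of_ne (by omega), Function.update_of_ne (by omega)]
      rfl
    refine .zero_seq (hW (hlen _) h0 (hrγ 0) (hlen _) hr0) ?_
    rw [update_st_two]
    refine .zero_seq (hW h0 h0 (hrγ 0) (hlen _) hr0) ?_
    rw [update_st_four]
    refine .zero_seq (hW h0 h0 h0 (hlen _) hr0) ?_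
    rw [update_st_five]
    simpa using Runs.succ (hW h0 h0 h0 h0 hr0) 0
  obtain ⟨δ₃, h3⟩ := hpost
  exact ⟨_, (hδ.le.trans le_self_add).trans le_add_self, h1.seq (h2.seq h3)⟩

/-- The tally over all `ι < β` halts after more than `f ι` steps for every `ι`, so its running time
bounds the range of `f`. -/
theorem IsUWeak.isWITRMRegular (hα : Ordinal.omega0 < α) (h : IsUWeak α) : IsWITRMRegular α := by
  have hcl := PairClosed.of_isUWeak hα h
  have hlim := hcl.isSuccLimit hα
  have h0 : (0 : Ordinal.{u}) < α := Ordinal.omega0_pos.trans hα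
  rintro ⟨β, hβ, f, hf, P, ξ, hξ, hP⟩
  obtain ⟨ζ, hζ, s, hs⟩ := exists_load hcl h0 (w := fun j => if j = 0 then β else ξ)
    (fun j => by split; exacts [hβ, hξ]) 2
  have hload := hs 0 0 h0 fun _ => h0
  set v : ℕ → Ordinal.{u} := fun j => if j < 2 then if j = 0 then β else ξ else (0 : ℕ → _) j
    with hv
  have hvα : ∀ j, v j < α := fun j => by
    rw [hv]; dsimp only; split
    · split
      exacts [hβ, hξ]
    · exact h0
  have hv1 : v 1 = ξ := by simp [hv]
  have hv0 : v 0 = β := by simp [hv]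
  -- The two inputs have to be cleared even if `P` changes neither of their registers.
  set n := max (regBound P) 2
  have hW : ∀ ι < α, Within α 0 (st ι 0 0 0 0 0 0 0 v) := fun ι hι =>
    within_zero_st.2 ⟨hι, h0, h0, h0, h0, h0, h0, fun _ => h0, hvα⟩
  obtain ⟨δ, -, hδ, hloop⟩ := exists_exec_loop (α := α) (m := 0) (s := tallyStmt P n)
    (b := .not (.eq 0 (par 0))) (σ := fun ι => st ι 0 0 0 0 0 0 0 v) (β := β)
    (τ := fun ι => if h : ι < β then (f ⟨ι, h⟩).1 else 0)
    (fun ι hι => by simpa [JumpCond.Holds, hv0] using hι.ne) (by simp [JumpCond.Holds, hv0])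
    (fun ι hι => hW ι (hι.trans_lt hβ))
    (fun ι hι => by
      obtain ⟨γ, d, h1, h2⟩ := hP ⟨ι, hι⟩
      obtain ⟨δ, h3, h4⟩ := exists_exec_tallyStmt hα (le_max_left (regBound P) 2) (le_max_right _ _)
        (hι.trans hβ) hvα (hv1 ▸ h1)
      exact ⟨δ, by simpa [hι, ← h2] using h3, h4.mono inf_le_left⟩)
    (fun l _ hl => by
      have hl0 := hl.bot_lt
      exact isLiminf_st (.id hl) (.const hl0 _) (.const hl0 _) (.const hl0 _) (.const hl0 _)
        (.const hl0 _) (.const hl0 _) (fun _ => .const hl0 _) fun _ => .const hl0 _)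
  -- The single input is the code of `β` and `ξ`. It is moved to register 1, where the decoder
  -- expects it, and register 0 becomes the counter.
  have hall : Runs α 0 (.copy 0 1 ;; .zero 0 ;; s) (st ζ 0 0 0 0 0 0 0 0)
      (st 0 0 0 0 0 0 0 0 v) := by
    refine .copy_seq (by simp [within_zero_st, *]) ?_
    rw [update_st_one, st_zero]
    refine .zero_seq (by simp [within_zero_st, *]) ?_
    rwa [update_st_zero]
  obtain ⟨γ, hγ⟩ := hall
  have hlt := h (γ + δ) ⟨_, ζ, hζ, _,
    init_single ζ ▸ (hγ.seq hloop).haltsIn (within_zero.1 (hW β hβ))⟩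
  obtain ⟨_, ⟨ι, rfl⟩, hle⟩ := hf ⟨γ + δ, hlt⟩
  have h1 := hδ ι.1 ι.2
  rw [dif_pos (show ι.1 < β from ι.2)] at h1
  exact absurd ((Subtype.coe_le_coe.2 hle).trans_lt h1) (le_add_self.not_gt)

end

/-! ### Regularity implies weakness -/

/-- If a computation halts after the limit time `α`, then the configuration at time `α` does not
occur cofinally often before `α`. -/
theorem exists_forall_comp_ne {P : RegProgram} {c : RegConfig.{u}} {α γ : Ordinal.{u}}
    (hα : Order.IsSuccLimit α) (hαγ : α ≤ γ) (hrun : ∀ t < γ, ¬ (comp P c t).IsHalted P)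
    (hhalt : (comp P c γ).IsHalted P) :
    ∃ s < α, ∀ t, s ≤ t → t < α → comp P c t ≠ comp P c α := by
  by_contra! hX
  have hX' : ∀ s < α, ∃ t, s ≤ t ∧ t < α ∧ comp P c t = comp P c α := hX
  set e := comp P c α with he
  obtain ⟨t₀, -, ht₀, hc₀⟩ := hX' 0 hα.bot_lt
  -- Searching from `t + 1` on makes the return time positive.
  have hnext : ∀ t < α, ∃ y, 0 < y ∧ t + y < α ∧ comp P c (t + y) = e := fun t ht => by
    obtain ⟨t', h1, h2, h3⟩ := hX' (t + 1) (hα.add_one_lt ht)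
    obtain ⟨y, rfl⟩ := le_iff_exists_add.1 h1
    exact ⟨1 + y, zero_lt_one.trans_le le_self_add, by rwa [← add_assoc], by rwa [← add_assoc]⟩
  have hper : {y | 0 < y ∧ comp P e y = e}.Nonempty := by
    obtain ⟨y, h1, -, h3⟩ := hnext t₀ ht₀
    exact ⟨y, h1, by rwa [comp_add, hc₀] at h3⟩
  -- With the least period `y`, every return to `e` takes at least `y` steps, so a whole cycle
  -- started at an occurrence of `e` below `α` ends below `α`.
  obtain ⟨y, ⟨hy0, hy⟩, hmin⟩ := WellFounded.has_min wellFounded_lt _ hper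
  have hlt : ∀ t < α, comp P c t = e → t + y < α := fun t ht htc => by
    obtain ⟨z, h1, h2, h3⟩ := hnext t ht
    rw [comp_add, htc] at h3
    have h4 := not_lt.1 (hmin z ⟨h1, h3⟩)
    exact lt_of_le_of_lt (by gcongr) h2
  have hcof : ∀ x < y, ∀ s < α, ∃ t, s ≤ t ∧ t < α ∧ comp P c t = comp P e x :=
    fun x hx s hs => by
      obtain ⟨t, h1, h2, h3⟩ := hX' s hs
      refine ⟨t + x, h1.trans le_self_add, lt_trans (by gcongr) (hlt t h2 h3), ?_⟩
      rw [comp_add, h3]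
  have hlim := isLiminfConfig_comp P c hα
  -- Every configuration of the cycle occurs cofinally often below `α`, so it lies componentwise
  -- above the inferior limit `e`. The cycle therefore leads back to `e` at limits of rounds too,
  -- and none of its configurations is halted.
  have hit : Reach P (fun x => ¬ x.IsHalted P) e (osum (fun _ => y) (γ + 1)) e := by
    refine Reach.iterate (A := fun _ => e) (γ := fun _ => y) (fun _ _ => hy0)
      (fun _ _ => ⟨hy, fun x hx => ⟨?_, ?_, fun i => ?_⟩⟩)
      fun l _ hl => ⟨.const hl.bot_lt _, fun _ => .const hl.bot_lt _⟩
    · obtain ⟨t, -, h1, h2⟩ := hcof x hx 0 hα.bot_lt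
      exact h2 ▸ hrun t (h1.trans_le hαγ)
    · rw [min_self]
      refine hlim.1.le_of_frequently fun s hs => ?_
      obtain ⟨t, h1, h2, h3⟩ := hcof x hx s hs
      exact ⟨t, h1, h2, by rw [h3]⟩
    · rw [min_self]
      refine (hlim.2 i).le_of_frequently fun s hs => ?_
      obtain ⟨t, h1, h2, h3⟩ := hcof x hx s hs
      exact ⟨t, h1, h2, by rw [h3]⟩
  obtain ⟨z, rfl⟩ := le_iff_exists_add.1 hαγ
  refine hit.2 z ?_ (by rwa [he, ← comp_add])
  -- Enough rounds to outlast the supposed halting time `z` after `α`.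
  have h1 : α + z + 1 ≤ osum (fun _ => y) (α + z + 1) := le_osum fun _ _ => hy0
  exact (le_add_self.trans_lt (lt_add_one _)).trans_le h1

/-! ### Recognising time `α` by its configuration -/

/-- The simulated line is the content of `par 2`, and the first `n` simulated registers have the
contents of the registers `par 3`, `par 4`, … -/
def configCond : ℕ → JumpCond
  | 0 => .eq 2 (par 2)
  | n + 1 => .and (configCond n) (.eq (sim n) (par (3 + n)))

theorem holds_configCond {n : ℕ} {a x p q t T d : Ordinal.{u}} {r v : ℕ → Ordinal.{u}} :
    (configCond n).Holds (st a x p q t T d r v) ↔ p = v 2 ∧ ∀ j < n, r j = v (3 + j) := by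
  induction n with
  | zero => simp [configCond, JumpCond.Holds]
  | succ n ih =>
    simp only [configCond, JumpCond.Holds, ih, st_sim, st_par, and_assoc]
    refine and_congr_right fun _ => ⟨fun h j hj => ?_, fun h => ⟨fun j hj => h j (by omega),
      h n (by omega)⟩⟩
    rcases Nat.lt_succ_iff_lt_or_eq.1 hj with h1 | rfl
    exacts [h.1 j h1, h.2]

/-- The computation `P(ζ)` runs beyond the limit `α` with register contents below `α`; the
parameters `v` contain `ζ`, a time `v 1 < α` after which the configuration at time `α` does not
occur before `α`, and that configuration. -/
structure LongRun (α : Ordinal.{u}) (P : RegProgram) (n : ℕ) (c : RegConfig.{u})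
    (v : ℕ → Ordinal.{u}) : Prop where
  omega0_lt : Ordinal.omega0 < α
  limit : Order.IsSuccLimit α
  bound : regBound P ≤ n
  one_le : 1 ≤ n
  param_lt : ∀ j, v j < α
  init : c = RegConfig.init [v 0]
  reg_lt : ∀ t ≤ α, ∀ i, (comp P c t).reg i < α
  line_lt : ∀ t ≤ α, (comp P c t).line < P.length
  ne : ∀ t, v 1 ≤ t → t < α → comp P c t ≠ comp P c α
  param_line : v 2 = ((comp P c α).line : Ordinal.{u})
  param_reg : ∀ j < n, v (3 + j) = (comp P c α).reg j

namespace LongRun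

variable {α : Ordinal.{u}} {P : RegProgram} {n : ℕ} {c : RegConfig.{u}} {v : ℕ → Ordinal.{u}}

theorem pos (h : LongRun α P n c v) : 0 < α := h.limit.bot_lt

theorem reg_of_le (h : LongRun α P n c v) {j : ℕ} (hj : n ≤ j) (t : Ordinal.{u}) :
    (comp P c t).reg j = 0 := by
  rw [comp_reg_of_le c (h.bound.trans hj), h.init, init_single_reg,
    Function.update_of_ne (by have := h.one_le; omega)]
  rfl

theorem within (h : LongRun α P n c v) {a x q t T d s : Ordinal.{u}} (ha : a < α) (hx : x < α)
    (hq : q < α) (ht : t < α) (hT : T < α) (hd : d < α) (hs : s ≤ α) :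
    Within α 0 (st a x (min (comp P c s).line P.length : ℕ) q t T d (comp P c s).reg v) :=
  within_zero_st.2 ⟨ha, hx, natCast_lt_of_omega0_lt h.omega0_lt _, hq, ht, hT, hd, h.reg_lt s hs,
    h.param_lt⟩

/-- Registers from `n` on stay `0`, so comparing the line and `n` registers identifies the whole
configuration. -/
theorem holds_configCond_iff (h : LongRun α P n c v) {a x q t T d s : Ordinal.{u}} (hs : s ≤ α) :
    (configCond n).Holds
      (st a x (min (comp P c s).line P.length : ℕ) q t T d (comp P c s).reg v) ↔
      comp P c s = comp P c α := by
  rw [holds_configCond, min_eq_left (h.line_lt s hs).le, h.param_line, Nat.cast_inj]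
  constructor
  · rintro ⟨h1, h2⟩
    refine RegConfig.ext h1 (funext fun j => ?_)
    rcases lt_or_ge j n with hj | hj
    · rw [h2 j hj, h.param_reg j hj]
    · rw [h.reg_of_le hj, h.reg_of_le hj]
  · intro h1
    rw [h1]
    exact ⟨rfl, fun j hj => (h.param_reg j hj).symm⟩

end LongRun

/-! ### First case: a register falls below its inferior limit cofinally often -/

/-- Restart `P`, and run it until at some time after the time in register `5` the `j`-th register
of `P` has the content of the register `0`, or the configuration given by the parameters is
reached. In the first case increase the time in register `5`, in the second raise a flag. -/
def searchStmt (P : RegProgram) (n j : ℕ) : Stmt :=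
  .copy (par 0) (sim 0) ;;
  simLoop P (.not (.and (.eq 4 5) (.or (.eq (sim j) 0) (configCond n)))) (.eq 4 5) ;;
  .ite (.eq (sim j) 0) (.succ 5) (.succ 6) ;; clearStmt n ;; .zero 2 ;; .zero 4

namespace LongRun

variable {α : Ordinal.{u}} {P : RegProgram} {n : ℕ} {c : RegConfig.{u}} {v : ℕ → Ordinal.{u}}

/-- From time `v 1` on, the configuration at `α` first appears at `α`. So the simulation stops
either at the first occurrence of `η` from `T` on or exactly at `α`, where register `j` is not `η`
because `η` is smaller. One comparison then tells the cases apart. -/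
theorem runs_searchStmt (h : LongRun α P n c v) {j : ℕ} {η T : Ordinal.{u}}
    (hη : η < (comp P c α).reg j) (h1T : v 1 ≤ T) (hT : T < α) :
    ((∃ t, T ≤ t ∧ t < α ∧ (comp P c t).reg j = η) →
      Runs α (st η 0 0 0 0 T 0 0 v) (searchStmt P n j) (st η 0 0 0 0 T 0 0 v)
        (st η 0 0 0 0 (T + 1) 0 0 v)) ∧
    ((∀ t, T ≤ t → t < α → (comp P c t).reg j ≠ η) →
      Runs α (st η 0 0 0 0 T 0 0 v) (searchStmt P n j) (st η 0 0 0 0 T 0 0 v)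
        (st η 0 0 0 0 T 1 0 v)) := by
  have h0 := h.pos
  have hηα : η < α := hη.trans (h.reg_lt α le_rfl j)
  have h1 : (1 : Ordinal.{u}) < α := by simpa using h.limit.add_one_lt h0
  have hT' := h.limit.add_one_lt hT
  have hv := h.param_lt
  have hlen := natCast_lt_of_omega0_lt h.omega0_lt
  have hW : ∀ {p t T' d : Ordinal.{u}} {r : ℕ → Ordinal.{u}}, p < α → t < α → T ≤ T' → T' < α →
      d < α → (∀ j, r j < α) → Within α (st η 0 0 0 0 T 0 0 v) (st η 0 p 0 t T' d r v) :=
    fun hp ht hT hT' hd hr => by simp [within_st_iff, *]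
  have hr0 : ∀ j, (0 : ℕ → Ordinal.{u}) j < α := fun _ => h0
  have hsim : ∀ β ≤ α, T ≤ β → (∀ t, T ≤ t → t < β → (comp P c t).reg j ≠ η) →
      ((comp P c β).reg j = η ∨ β = α) → Runs α (st η 0 0 0 0 T 0 0 v)
        (simLoop P (.not (.and (.eq 4 5) (.or (.eq (sim j) 0) (configCond n)))) (.eq 4 5))
        (st η 0 0 0 0 T 0 c.reg v)
        (st η 0 (min (comp P c β).line P.length : ℕ) 0 T T 0 (comp P c β).reg v) := by
    intro β hβα hTβ hne hβ
    -- The step counter is `min ι T`: it only has to tell whether time `T` has been reached, and an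
    -- unrestricted counter would reach `α`.
    have key := runs_simLoop (α := α) (m := st η 0 0 0 0 T 0 0 v) (a := η) (x := 0) (T := T)
      (d := 0) (v := v) (c := c) (β := β) (e := fun ι => min ι T)
      (b := .not (.and (.eq 4 5) (.or (.eq (sim j) 0) (configCond n)))) (h := .eq 4 5)
      h.omega0_lt (fun t ht => ?_) ?_ (fun t ht => ?_) (fun l _ hl => (IsLiminf.id hl).min_right T)
      (fun t ht => hW (hlen _) ((min_le_right _ _).trans_lt hT) le_rfl hT h0
        (h.reg_lt t (ht.trans hβα))) (fun t ht => not_le.2 (h.line_lt t (ht.le.trans hβα)))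
    · simpa [h.init, RegConfig.init, hTβ] using key
    · rintro ⟨h2, h3⟩
      have h4 : T ≤ t := min_eq_right_iff.1 h2
      rcases h3 with h3 | h3
      · simp only [JumpCond.Holds, st_sim, st_zero] at h3
        exact hne t h4 ht h3
      · rw [h.holds_configCond_iff (ht.le.trans hβα)] at h3
        exact h.ne t (h1T.trans h4) (ht.trans_le hβα) h3
    · refine fun h2 => h2 ⟨by simp [JumpCond.Holds, hTβ], ?_⟩
      rcases hβ with h3 | rfl
      · exact .inl (by simpa [JumpCond.Holds] using h3)
      · exact .inr ((h.holds_configCond_iff le_rfl).2 rfl)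
    · simp only [JumpCond.Holds, st_four, st_five, min_eq_right_iff]
      rcases le_or_gt T t with h2 | h2
      · exact .inl ⟨h2, by rw [min_eq_right h2, min_eq_right (h2.trans le_self_add)]⟩
      · exact .inr ⟨h2.not_ge, by
          rw [min_eq_left h2.le, min_eq_left (Order.add_one_le_of_lt h2)]⟩
  have hpre : ∀ {s : Stmt} {σ : ℕ → Ordinal.{u}},
      Runs α (st η 0 0 0 0 T 0 0 v) s (st η 0 0 0 0 T 0 c.reg v) σ →
      Runs α (st η 0 0 0 0 T 0 0 v) (.copy (par 0) (sim 0) ;; s) (st η 0 0 0 0 T 0 0 v) σ := by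
    intro s σ hs
    refine .copy_seq (hW h0 h0 le_rfl hT h0 hr0) ?_
    rwa [st_par, update_st_sim, ← init_single_reg, ← h.init]
  have hpost : ∀ β ≤ α, ∀ T' d, T ≤ T' → T' < α → d < α → Runs α (st η 0 0 0 0 T 0 0 v)
      (clearStmt n ;; .zero 2 ;; .zero 4)
      (st η 0 (min (comp P c β).line P.length : ℕ) 0 T T' d (comp P c β).reg v)
      (st η 0 0 0 0 T' d 0 v) := by
    intro β hβ T' d hTT' hT' hd
    refine (runs_clearStmt (hW (hlen _) hT hTT' hT' hd hr0) (h.reg_lt β hβ)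
      fun j hj => h.reg_of_le hj β).seq ?_
    refine .zero_seq (hW (hlen _) hT hTT' hT' hd hr0) ?_
    rw [update_st_two]
    simpa using Runs.zero (hW h0 hT hTT' hT' hd hr0) 4
  constructor
  · intro hex
    obtain ⟨β, ⟨hTβ, hβα, hβ⟩, hmin⟩ := WellFounded.has_min wellFounded_lt
      {t | T ≤ t ∧ t < α ∧ (comp P c t).reg j = η} hex
    refine hpre ((hsim β hβα.le hTβ (fun t h2 h3 h4 => hmin t ⟨h2, h3.trans hβα, h4⟩ h3)
      (.inl hβ)).seq (.seq (.ite_true (hW (hlen _) hT le_rfl hT h0 (h.reg_lt β hβα.le))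
      (by simpa [JumpCond.Holds] using hβ) (Runs.succ (hW (hlen _) hT le_rfl hT h0
      (h.reg_lt β hβα.le)) 5)) ?_))
    rw [update_st_five, st_five]
    exact hpost β hβα.le _ _ le_self_add hT' h0
  · intro hall
    refine hpre ((hsim α le_rfl hT.le hall (.inr rfl)).seq (.seq
      (σ' := st η 0 (min (comp P c α).line P.length : ℕ) 0 T T 1 (comp P c α).reg v)
      (.ite_false (hW (hlen _) hT le_rfl hT h0 (h.reg_lt α le_rfl))
      (by simpa [JumpCond.Holds] using hη.ne') ?_ (hW (hlen _) hT le_rfl hT h1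
      (h.reg_lt α le_rfl))) ?_))
    · simpa using Runs.succ (hW (hlen _) hT le_rfl hT h0 (h.reg_lt α le_rfl)) 6
    · exact hpost α le_rfl _ _ le_rfl hT h1

/-- The search for the least time after which the `j`-th register of `P` does not have the content
of register `0`. -/
theorem runs_search (h : LongRun α P n c v) {j : ℕ} {η T : Ordinal.{u}}
    (hη : η < (comp P c α).reg j) (h1T : v 1 ≤ T) (hT : T < α)
    (hall : ∀ t, T ≤ t → t < α → (comp P c t).reg j ≠ η)
    (hmin : ∀ S, v 1 ≤ S → S < T → ∃ t, S ≤ t ∧ t < α ∧ (comp P c t).reg j = η) :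
    Runs α 0 (.copy (par 1) 5 ;; .loop (.eq 6 3) (searchStmt P n j) ;; .copy 5 0)
      (st η 0 0 0 0 0 0 0 v) (st T 0 0 0 0 T 1 0 v) := by
  have h0 := h.pos
  have hηα : η < α := hη.trans (h.reg_lt α le_rfl j)
  have h1 : (1 : Ordinal.{u}) < α := by simpa using h.limit.add_one_lt h0
  have hr0 : ∀ j, (0 : ℕ → Ordinal.{u}) j < α := fun _ => h0
  have hW : ∀ {T d : Ordinal.{u}}, T < α → d < α → Within α 0 (st η 0 0 0 0 T d 0 v) :=
    fun hT hd => within_zero_st.2 ⟨hηα, h0, h0, h0, h0, hT, hd, hr0, h.param_lt⟩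
  obtain ⟨κ, rfl⟩ := le_iff_exists_add.1 h1T
  refine .copy_seq (hW h0 h0) ?_
  rw [update_st_five, st_par]
  have hle : ∀ ι, v 1 + min ι κ < α := fun ι =>
    lt_of_le_of_lt (by gcongr; exact min_le_right _ _) hT
  -- With `T = v 1 + κ`, the first `κ` passes each raise the candidate by one, and pass `κ` raises
  -- the flag. Register 3 is `0`, so the loop runs while the flag is down.
  have key := Runs.loop (α := α) (m := 0) (b := .eq 6 3) (s := searchStmt P n j) (β := κ + 1)
    (σ := fun ι => st η 0 0 0 0 (v 1 + min ι κ) (if ι ≤ κ then 0 else 1) 0 v) (fun ι hι => ?_) ?_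
    (fun ι hι => hW (hle ι) (by split; exacts [h0, h1])) (fun ι hι => ?_) (fun l hl hlim => ?_)
  · simp only [min_eq_right (le_self_add : κ ≤ κ + 1), (lt_add_one κ).not_ge, if_false, zero_le,
      if_true, min_eq_left, add_zero] at key
    refine key.seq ?_
    simpa using Runs.copy (hW hT h1) 5 0
  · simp [JumpCond.Holds, Order.lt_add_one_iff.1 hι]
  · simp [JumpCond.Holds]
  · have hικ := Order.lt_add_one_iff.1 hι
    refine Runs.mono ?_ inf_le_left
    simp only [hικ, if_true, min_eq_left]
    rcases hικ.eq_or_lt with rfl | hικ'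
    · simpa [(lt_add_one ι).not_ge] using (h.runs_searchStmt hη h1T hT).2 hall
    · have h3 := Order.add_one_le_of_lt hικ'
      simp only [h3, if_true, min_eq_left]
      rw [← add_assoc]
      have h4 : v 1 + ι < v 1 + κ := by gcongr
      exact (h.runs_searchStmt hη le_self_add (h4.trans hT)).1 (hmin _ le_self_add h4)
  · have hl0 := hlim.bot_lt
    have hlκ : l ≤ κ := by
      rcases hl.eq_or_lt with rfl | h2
      · exact absurd hlim.isSuccPrelimit (Order.not_isSuccPrelimit_succ κ)
      · exact Order.lt_add_one_iff.1 h2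
    simp only [hlκ, if_true, min_eq_left]
    exact isLiminf_st (.const hl0 _) (.const hl0 _) (.const hl0 _) (.const hl0 _) (.const hl0 _)
      ((IsLiminf.add_left (v 1) hlim).congr fun t ht => by rw [min_eq_left (ht.le.trans hlκ)])
      ((IsLiminf.const hl0 0).congr fun t ht => by rw [if_pos (ht.le.trans hlκ)])
      (fun _ => .const hl0 _) fun _ => .const hl0 _

/-- If a register content falls cofinally often below its inferior limit at `α`, then `α` is
singular. -/
theorem isWITRMSingular_of_frequently_lt (h : LongRun α P n c v) {ξ : Ordinal.{u}} (hξ : ξ < α)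
    {s : Stmt} (hs : ∀ a < α, Runs α 0 s (st a ξ 0 0 0 0 0 0 0) (st a 0 0 0 0 0 0 0 v)) {j : ℕ}
    (hj : ∀ x < α, ∃ t, x ≤ t ∧ t < α ∧ (comp P c t).reg j < (comp P c α).reg j) :
    IsWITRMSingular α := by
  set ρ := (comp P c α).reg j
  have h0 := h.pos
  have h1 : (1 : Ordinal.{u}) < α := by simpa using h.limit.add_one_lt h0
  have hρ : ρ < α := h.reg_lt α le_rfl j
  -- Such a `T` exists because `η` is below the inferior limit `ρ`; the least one is the value at
  -- `η`.
  have hex : ∀ η : Set.Iio ρ, ∃ T, (v 1 ≤ T ∧ T < α ∧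
      ∀ t, T ≤ t → t < α → (comp P c t).reg j ≠ η.1) ∧
      ∀ S, v 1 ≤ S → S < T → ∃ t, S ≤ t ∧ t < α ∧ (comp P c t).reg j = η.1 := by
    intro η
    have hne : {T | v 1 ≤ T ∧ T < α ∧
        ∀ t, T ≤ t → t < α → (comp P c t).reg j ≠ η.1}.Nonempty := by
      obtain ⟨S, hS, h2⟩ := ((isLiminfConfig_comp P c h.limit).2 j).1 η.1 η.2
      exact ⟨max (v 1) S, le_max_left _ _, max_lt (h.param_lt 1) hS,
        fun t h3 h4 => (h2 t ((le_max_right _ _).trans h3) h4).ne'⟩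
    obtain ⟨T, hT, hmin⟩ := WellFounded.has_min wellFounded_lt _ hne
    refine ⟨T, hT, fun S h2 h3 => ?_⟩
    by_contra! h4
    exact hmin S ⟨h2, h3.trans hT.2.1, h4⟩ h3
  choose f hf hfmin using hex
  refine ⟨ρ, hρ, fun η => ⟨f η, (hf η).2.1⟩, fun y => ?_,
    (s ;; .copy (par 1) 5 ;; .loop (.eq 6 3) (searchStmt P n j) ;; .copy 5 0).code 0, ξ, hξ,
    fun η => ?_⟩
  -- For the content `η < ρ` that occurs at a time `t ≥ y`, the value at `η` exceeds `t`.
  · obtain ⟨t, h2, h3, h4⟩ := hj y.1 y.2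
    refine ⟨_, ⟨⟨_, h4⟩, rfl⟩, ?_⟩
    by_contra hlt
    have hlt' : f ⟨_, h4⟩ < y.1 := not_le.1 fun h' => hlt h'
    exact (hf ⟨_, h4⟩).2.2 t (hlt'.le.trans h2) h3 rfl
  · obtain ⟨γ, hγ⟩ := (hs η.1 (η.2.trans hρ)).seq
      (h.runs_search η.2 (hf η).1 (hf η).2.1 (hf η).2.2 (hfmin η))
    refine ⟨γ, _, init_pair η.1 ξ ▸ hγ.haltsIn ?_, rfl⟩
    have hfη := (hf η).2.1
    exact within_zero.1 (within_zero_st.2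
      ⟨hfη, h0, h0, h0, h0, hfη, h1, fun _ => h0, h.param_lt⟩)

end LongRun

/-! ### Second case: all registers eventually stay at or above their inferior limits -/

/-- Run `P`, counting steps, until the active line has been the one in `par 2`, then until the
first register has had the content of `par 3`, and so on for the first `n` registers. -/
def sweepStmt (P : RegProgram) : ℕ → Stmt
  | 0 => simLoop P (.not (.eq 2 (par 2))) (.not (.eq 0 0))
  | n + 1 => sweepStmt P n ;; simLoop P (.not (.eq (sim n) (par (3 + n)))) (.not (.eq 0 0))

namespace LongRun

variable {α : Ordinal.{u}} {P : RegProgram} {n : ℕ} {c : RegConfig.{u}} {v : ℕ → Ordinal.{u}}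

/-- Running `P` up to the first time at which `b` holds. -/
theorem runs_simLoop_until (h : LongRun α P n c v) {b : JumpCond} {a d τ τ' : Ordinal.{u}}
    (ha : a < α) (hd : d < α) (hττ' : τ ≤ τ') (hτ' : τ' < α)
    (hb : ∀ t, τ ≤ t → t < τ' → ¬ b.Holds
      (st a 0 (min (comp P c t).line P.length : ℕ) 0 t 0 d (comp P c t).reg v))
    (hb' : b.Holds (st a 0 (min (comp P c τ').line P.length : ℕ) 0 τ' 0 d (comp P c τ').reg v)) :
    Runs α 0 (simLoop P (.not b) (.not (.eq 0 0)))
      (st a 0 (min (comp P c τ).line P.length : ℕ) 0 τ 0 d (comp P c τ).reg v)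
      (st a 0 (min (comp P c τ').line P.length : ℕ) 0 τ' 0 d (comp P c τ').reg v) := by
  obtain ⟨β, rfl⟩ := le_iff_exists_add.1 hττ'
  have hlt : ∀ ι ≤ β, τ + ι < α := fun ι hι => lt_of_le_of_lt (by gcongr) hτ'
  have key := runs_simLoop (α := α) (m := 0) (a := a) (x := 0) (T := 0)
      (d := d) (v := v) (c := comp P c τ) (β := β) (e := fun ι => τ + ι)
      (b := .not b) (h := .not (.eq 0 0)) (P := P)
      h.omega0_lt (fun t ht => ?_) ?_ (fun t ht => .inr ⟨fun h' => h' rfl, (add_assoc ..).symm⟩)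
      (fun l _ hl => IsLiminf.add_left τ hl) (fun t ht => ?_) (fun t ht => ?_)
  · simpa only [← comp_add, add_zero] using key
  · simpa only [← comp_add, JumpCond.Holds] using hb _ le_self_add (by gcongr)
  · simpa only [← comp_add, JumpCond.Holds, not_not] using hb'
  · simpa only [← comp_add] using
      h.within ha h.pos h.pos (hlt t ht) h.pos hd (hlt t ht).le
  · rw [← comp_add]
    exact not_le.2 (h.line_lt _ (hlt t ht.le).le)

/-- Since `B` recurs cofinally, the wait ends below `α`, so all steps can be counted in register 4.
-/
theorem exists_until (h : LongRun α P n c v) {b : JumpCond} {B : Ordinal.{u} → Prop}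
    (hb : ∀ a d t, t ≤ α → (b.Holds
      (st a 0 (min (comp P c t).line P.length : ℕ) 0 t 0 d (comp P c t).reg v) ↔ B t))
    (hB : ∀ x < α, ∃ t, x ≤ t ∧ t < α ∧ B t) {τ : Ordinal.{u}} (hτ : τ < α) :
    ∃ τ', τ ≤ τ' ∧ τ' < α ∧ B τ' ∧ ∀ a < α, ∀ d < α, Runs α 0 (simLoop P (.not b) (.not (.eq 0 0)))
      (st a 0 (min (comp P c τ).line P.length : ℕ) 0 τ 0 d (comp P c τ).reg v)
      (st a 0 (min (comp P c τ').line P.length : ℕ) 0 τ' 0 d (comp P c τ').reg v) := by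
  obtain ⟨τ', ⟨h1, h2, h3⟩, hmin⟩ := WellFounded.has_min wellFounded_lt
    {t | τ ≤ t ∧ t < α ∧ B t} (hB τ hτ)
  refine ⟨τ', h1, h2, h3, fun a ha d hd => h.runs_simLoop_until ha hd h1 h2 (fun t h4 h5 => ?_)
    ((hb _ _ _ h2.le).2 h3)⟩
  rw [hb _ _ _ (h5.trans h2).le]
  exact fun h6 => hmin t ⟨h4, h5.trans h2, h6⟩ h5

/-- One round: each component of the configuration at time `α` is met. -/
theorem exists_sweep (h : LongRun α P n c v)
    (hline : ∀ x < α, ∃ t, x ≤ t ∧ t < α ∧ (comp P c t).line = (comp P c α).line)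
    (hreg : ∀ j < n, ∀ x < α, ∃ t, x ≤ t ∧ t < α ∧ (comp P c t).reg j = (comp P c α).reg j)
    {k : ℕ} (hk : k ≤ n) {τ : Ordinal.{u}} (hτ : τ < α) :
    ∃ τ', τ ≤ τ' ∧ τ' < α ∧ (∃ t, τ ≤ t ∧ t ≤ τ' ∧ (comp P c t).line = (comp P c α).line) ∧
      (∀ j < k, ∃ t, τ ≤ t ∧ t ≤ τ' ∧ (comp P c t).reg j = (comp P c α).reg j) ∧
      ∀ a < α, ∀ d < α, Runs α 0 (sweepStmt P k)
        (st a 0 (min (comp P c τ).line P.length : ℕ) 0 τ 0 d (comp P c τ).reg v)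
        (st a 0 (min (comp P c τ').line P.length : ℕ) 0 τ' 0 d (comp P c τ').reg v) := by
  induction k with
  | zero =>
    obtain ⟨τ', h1, h2, h3, h4⟩ := h.exists_until (b := .eq 2 (par 2))
      (B := fun t => (comp P c t).line = (comp P c α).line) (fun a d t ht => by
        simp only [JumpCond.Holds, st_two, st_par, h.param_line, Nat.cast_inj,
          min_eq_left (h.line_lt t ht).le]) hline hτ
    exact ⟨τ', h1, h2, ⟨τ', h1, le_rfl, h3⟩, fun j hj => absurd hj (Nat.not_lt_zero j), h4⟩
  | succ k ih =>
    obtain ⟨τ₁, h1, h2, ⟨t, h3, h4, h5⟩, h6, h7⟩ := ih (by omega)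
    obtain ⟨τ', g1, g2, g3, g4⟩ := h.exists_until (b := .eq (sim k) (par (3 + k)))
      (B := fun t => (comp P c t).reg k = (comp P c α).reg k) (fun a d t ht => by
        simp only [JumpCond.Holds, st_sim, st_par, h.param_reg k hk]) (hreg k hk) h2
    refine ⟨τ', h1.trans g1, g2, ⟨t, h3, h4.trans g1, h5⟩, fun j hj => ?_,
      fun a ha d hd => (h7 a ha d hd).seq (g4 a ha d hd)⟩
    rcases Nat.lt_succ_iff_lt_or_eq.1 hj with hj | rfl
    · obtain ⟨t, f1, f2, f3⟩ := h6 j hj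
      exact ⟨t, f1, f2.trans g1, f3⟩
    · exact ⟨τ', h1.trans g1, le_rfl, g3⟩

/-- One round, followed by one further step of `P`. -/
def roundStmt (P : RegProgram) (n : ℕ) : Stmt := sweepStmt P n ;; .succ 4 ;; interp P ;; .succ 6

/-- The additional step makes the round end strictly after all the meetings, so that the ends of the
rounds strictly increase. -/
theorem exists_round (h : LongRun α P n c v)
    (hline : ∀ x < α, ∃ t, x ≤ t ∧ t < α ∧ (comp P c t).line = (comp P c α).line)
    (hreg : ∀ j < n, ∀ x < α, ∃ t, x ≤ t ∧ t < α ∧ (comp P c t).reg j = (comp P c α).reg j)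
    {τ : Ordinal.{u}} (hτ : τ < α) :
    ∃ τ', τ < τ' ∧ τ' < α ∧ (∃ t, τ ≤ t ∧ t < τ' ∧ (comp P c t).line = (comp P c α).line) ∧
      (∀ j < n, ∃ t, τ ≤ t ∧ t < τ' ∧ (comp P c t).reg j = (comp P c α).reg j) ∧
      ∀ a < α, ∀ d < α, Runs α 0 (roundStmt P n)
        (st a 0 (min (comp P c τ).line P.length : ℕ) 0 τ 0 d (comp P c τ).reg v)
        (st a 0 (min (comp P c τ').line P.length : ℕ) 0 τ' 0 (d + 1) (comp P c τ').reg v) := by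
  obtain ⟨τ', h1, h2, ⟨t, h3, h4, h5⟩, h6, h7⟩ := h.exists_sweep hline hreg le_rfl hτ
  have h8 := h.limit.add_one_lt h2
  refine ⟨τ' + 1, Order.lt_add_one_iff.2 h1, h8, ⟨t, h3, Order.lt_add_one_iff.2 h4, h5⟩,
    fun j hj => ?_, fun a ha d hd => (h7 a ha d hd).seq ?_⟩
  · obtain ⟨t, f1, f2, f3⟩ := h6 j hj
    exact ⟨t, f1, Order.lt_add_one_iff.2 f2, f3⟩
  · refine .succ_seq (h.within ha h.pos h.pos h2 h.pos hd h2.le) ?_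
    rw [update_st_four, st_four]
    have hw := h.within (T := 0) (x := 0) (q := 0) ha h.pos h.pos h8 h.pos hd h8.le
    have hi := runs_interp h.omega0_lt (not_le.2 (h.line_lt τ' h2.le))
      (h.within (T := 0) (x := 0) (q := 0) ha h.pos h.pos h8 h.pos hd h2.le)
      (by rwa [comp_add_one] at hw)
    rw [← comp_add_one] at hi
    refine hi.seq ?_
    simpa using Runs.succ hw 6

/-- If no register content falls cofinally often below its inferior limit at `α`, then `α` is
singular. -/
theorem isWITRMSingular_of_eventually_le (h : LongRun α P n c v) {ξ : Ordinal.{u}} (hξ : ξ < α)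
    {s : Stmt} (hs : ∀ a < α, Runs α 0 s (st a ξ 0 0 0 0 0 0 0) (st a 0 0 0 0 0 0 0 v))
    (hle : ∀ j < n, ∀ t, v 1 ≤ t → t < α → (comp P c α).reg j ≤ (comp P c t).reg j)
    (hlle : ∀ t, v 1 ≤ t → t < α → (comp P c α).line ≤ (comp P c t).line) :
    IsWITRMSingular α := by
  have h0 := h.pos
  have hv1 := h.param_lt 1
  have hlim := isLiminfConfig_comp P c h.limit
  -- A value that is an inferior limit and an eventual lower bound is attained cofinally often.
  have hline : ∀ x < α, ∃ t, x ≤ t ∧ t < α ∧ (comp P c t).line = (comp P c α).line := by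
    intro x hx
    obtain ⟨t, h1, h2, h3⟩ := hlim.1.2 (max x (v 1)) (max_lt hx hv1)
    exact ⟨t, (le_max_left _ _).trans h1, h2,
      le_antisymm h3 (hlle t ((le_max_right _ _).trans h1) h2)⟩
  have hreg : ∀ j < n, ∀ x < α, ∃ t, x ≤ t ∧ t < α ∧
      (comp P c t).reg j = (comp P c α).reg j := by
    intro j hj x hx
    obtain ⟨t, h1, h2, h3⟩ := (hlim.2 j).2 (max x (v 1)) (max_lt hx hv1)
    exact ⟨t, (le_max_left _ _).trans h1, h2,
      le_antisymm h3 (hle j hj t ((le_max_right _ _).trans h1) h2)⟩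
  choose! g hg1 hg2 hg3 hg4 hg5 using fun τ (hτ : τ < α) => h.exists_round hline hreg hτ
  set f : ℕ → Ordinal.{u} := fun N => g^[N] (v 1) with hf
  have hf0 : f 0 = v 1 := rfl
  have hfs : ∀ N, f (N + 1) = g (f N) := fun N => Function.iterate_succ_apply' g N _
  have hfα : ∀ N, f N < α := fun N => by
    induction N with
    | zero => exact hv1
    | succ N ih => rw [hfs]; exact hg2 _ ih
  have hmono : StrictMono f := strictMono_nat_of_lt_succ fun N => by
    rw [hfs]; exact hg1 _ (hfα N)
  -- Otherwise the supremum `l < α` is a limit below which each component of the configuration at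
  -- `α` is met cofinally and bounds from below. The configuration at `l` is then the one at `α`,
  -- contrary to `h.ne`.
  have hcof : ∀ x < α, ∃ N, x ≤ f N := by
    by_contra! hx
    obtain ⟨x, hxα, hx⟩ := hx
    set l := ⨆ N, f N with hl
    have hlx : l ≤ x := Ordinal.iSup_le fun N => (hx N).le
    have hfl : ∀ N, f N < l := fun N =>
      (hmono (Nat.lt_succ_self N)).trans_le (Ordinal.le_iSup f (N + 1))
    have hcofl : ∀ s < l, ∃ N, s < f N := fun s hs => Ordinal.lt_iSup_iff.1 hs
    have hlimit : Order.IsSuccLimit l := by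
      refine Ordinal.isSuccLimit_iff.2 ⟨(zero_le.trans_lt (hfl 0)).ne',
        Order.isSuccPrelimit_of_succ_lt fun a ha => ?_⟩
      obtain ⟨N, hN⟩ := hcofl a ha
      exact (Order.succ_le_of_lt hN).trans_lt (hfl N)
    have hlα := hlx.trans_lt hxα
    have hv1l : v 1 ≤ l := (hfl 0).le
    refine h.ne l hv1l hlα ((isLiminfConfig_comp P c hlimit).unique ⟨?_, fun j => ?_⟩)
    · refine ⟨fun w hw => ⟨v 1, hfl 0, fun t h1 h2 => hw.trans_le (hlle t h1 (h2.trans hlα))⟩,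
        fun s hs => ?_⟩
      obtain ⟨N, hN⟩ := hcofl s hs
      obtain ⟨t, h1, h2, h3⟩ := hg3 _ (hfα N)
      rw [← hfs] at h2
      exact ⟨t, hN.le.trans h1, h2.trans (hfl _), h3.le⟩
    · rcases lt_or_ge j n with hj | hj
      · refine ⟨fun w hw => ⟨v 1, hfl 0, fun t h1 h2 =>
          hw.trans_le (hle j hj t h1 (h2.trans hlα))⟩, fun s hs => ?_⟩
        obtain ⟨N, hN⟩ := hcofl s hs
        obtain ⟨t, h1, h2, h3⟩ := hg4 _ (hfα N) j hj
        rw [← hfs] at h2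
        exact ⟨t, hN.le.trans h1, h2.trans (hfl _), h3.le⟩
      · simp only [h.reg_of_le hj]
        exact .const hlimit.bot_lt _
  have hnat := natCast_lt_of_omega0_lt h.omega0_lt
  -- Finitely many rounds only, so no limit of passes arises.
  have hloop : ∀ i k : ℕ, Runs α 0 (.loop (.not (.eq 6 0)) (roundStmt P n))
      (st (k + i : ℕ) 0 (min (comp P c (f k)).line P.length : ℕ) 0 (f k) 0 k (comp P c (f k)).reg v)
      (st (k + i : ℕ) 0 (min (comp P c (f (k + i))).line P.length : ℕ) 0 (f (k + i)) 0 (k + i : ℕ)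
        (comp P c (f (k + i))).reg v) := by
    intro i
    induction i with
    | zero =>
      exact fun k => .loop_false (h.within (hnat _) h0 h0 (hfα k) h0 (hnat _) (hfα k).le)
        (by simp [JumpCond.Holds])
    | succ i ih =>
      intro k
      have e : k + 1 + i = k + (i + 1) := by omega
      have hi := ih (k + 1)
      rw [e, Nat.cast_succ, hfs] at hi
      refine .loop_step (h.within (hnat _) h0 h0 (hfα k) h0 (hnat _) (hfα k).le) ?_
        (hg5 _ (hfα k) _ (hnat _) _ (hnat _)) ?_ hi
      · simp only [JumpCond.Holds, st_six, st_zero, Nat.cast_inj]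
        omega
      · rw [← hfs, ← Nat.cast_succ]
        exact h.within (hnat _) h0 h0 (hfα _) h0 (hnat _) (hfα _).le
  have hcode : ∀ N : ℕ, ∃ γ d, HaltsIn α
      ((s ;; .copy (par 0) (sim 0) ;; simLoop P (.not (.eq 4 (par 1))) (.not (.eq 0 0)) ;;
        .loop (.not (.eq 6 0)) (roundStmt P n) ;; .copy 4 0).code 0)
      (RegConfig.init [(N : Ordinal.{u}), ξ]) γ d ∧ d.reg 0 = f N := by
    intro N
    have hw := h.within (T := 0) (x := 0) (q := 0) (hnat N) h0 h0 (hfα N) h0 (hnat N) (hfα N).le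
    have hr : Runs α 0 (.copy (par 0) (sim 0) ;;
        simLoop P (.not (.eq 4 (par 1))) (.not (.eq 0 0)) ;;
        .loop (.not (.eq 6 0)) (roundStmt P n) ;; .copy 4 0) (st N 0 0 0 0 0 0 0 v)
        (st (f N) 0 (min (comp P c (f N)).line P.length : ℕ) 0 (f N) 0 N
          (comp P c (f N)).reg v) := by
      refine .copy_seq (within_zero_st.2
        ⟨hnat N, h0, h0, h0, h0, h0, h0, fun _ => h0, h.param_lt⟩) ?_
      rw [update_st_sim, st_par, ← init_single_reg, ← h.init]
      have h1 := h.runs_simLoop_until (b := .eq 4 (par 1)) (a := N) (d := 0) (τ := 0) (τ' := v 1)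
        (hnat N) h0 zero_le hv1 (fun t _ ht => by simpa [JumpCond.Holds] using ht.ne)
        (by simp [JumpCond.Holds])
      have h2 := hloop N 0
      simp only [zero_add, Nat.cast_zero, hf0] at h2
      have h3 : c.line = 0 := by rw [h.init]; rfl
      simp only [comp_zero, h3, Nat.zero_min, Nat.cast_zero] at h1
      refine h1.seq (h2.seq ?_)
      simpa using Runs.copy hw 4 0
    obtain ⟨γ, hγ⟩ := (hs N (hnat N)).seq hr
    exact ⟨γ, _, init_pair (N : Ordinal.{u}) ξ ▸ hγ.haltsIn (within_zero.1
      (h.within (hfα N) h0 h0 (hfα N) h0 (hnat N) (hfα N).le)), rfl⟩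
  choose nat hnat' using fun ι : Set.Iio Ordinal.omega0.{u} => Ordinal.lt_omega0.1 ι.2
  refine ⟨Ordinal.omega0, h.omega0_lt, fun ι => ⟨f (nat ι), hfα _⟩, fun y => ?_, _, ξ, hξ,
    fun ι => by rw [hnat' ι]; exact hcode (nat ι)⟩
  obtain ⟨N, hN⟩ := hcof y.1 y.2
  refine ⟨_, ⟨⟨N, Ordinal.natCast_lt_omega0 N⟩, rfl⟩, hN.trans_eq ?_⟩
  have h1 := hnat' ⟨N, Ordinal.natCast_lt_omega0 N⟩
  exact congrArg f (Nat.cast_inj.1 h1)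

end LongRun

/-- A halting time `≥ α` yields a `LongRun`, and in each of the two cases `α` is singular. -/
theorem IsWITRMRegular.isUWeak {α : Ordinal.{u}} (hω : Ordinal.omega0 < α)
    (hreg : IsWITRMRegular α) : IsUWeak α := by
  have hcl := PairClosed.of_isWITRMRegular hω hreg
  have hlim := hcl.isSuccLimit hω
  have h0 := hlim.bot_lt
  rintro γ ⟨P, ζ, hζ, d, hd⟩
  by_contra! hγ
  refine hreg ?_
  obtain ⟨hrα, hrun, rfl, hhalt⟩ := haltsIn_iff.1 hd
  set c := RegConfig.init [ζ] with hc
  obtain ⟨s₀, hs₀, hne⟩ := exists_forall_comp_ne hlim hγ hrun hhalt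
  have hL := isLiminfConfig_comp P c hlim
  have hline : ∀ t ≤ α, (comp P c t).line < P.length := by
    intro t ht
    have hlt : ∀ t < α, (comp P c t).line < P.length := fun t ht =>
      not_le.1 (hrun t (ht.trans_le hγ))
    rcases ht.eq_or_lt with rfl | ht
    · have h1 := hlt 0 h0
      -- An inferior limit of active lines is at most the last line of the program, also when `γ =
      -- α`.
      have h2 := hL.1.le_of_frequently (w := P.length - 1) fun s hs =>
        ⟨s, le_rfl, hs, Nat.le_sub_one_of_lt (hlt s hs)⟩
      omega
    · exact hlt t ht
  set n := max (regBound P) 1 with hn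
  -- The starting time `s₁` is left free, since the second case needs a later one than the first.
  have main : ∀ s₁, s₀ ≤ s₁ → s₁ < α → ∃ v ξ s, LongRun α P n c v ∧ v 1 = s₁ ∧ ξ < α ∧
      ∀ a < α, Runs α 0 s (st a ξ 0 0 0 0 0 0 0) (st a 0 0 0 0 0 0 0 v) := by
    intro s₁ hs₁ hs₁α
    obtain ⟨w, hw⟩ : ∃ w : ℕ → Ordinal.{u}, w = fun j => match j with
      | 0 => ζ
      | 1 => s₁
      | 2 => ((comp P c α).line : Ordinal.{u})
      | j + 3 => (comp P c α).reg j := ⟨_, rfl⟩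
    have hwα : ∀ j, w j < α := fun j => by
      subst hw
      rcases j with _ | _ | _ | j
      exacts [hζ, hs₁α, natCast_lt_of_omega0_lt hω _, hrα α hγ j]
    obtain ⟨ξ, hξ, s, hs⟩ := exists_load hcl h0 hwα (n + 3)
    refine ⟨fun j => if j < n + 3 then w j else 0, ξ, s, ⟨hω, hlim, le_max_left _ _,
      le_max_right _ _, fun j => ?_, ?_, fun t ht => hrα t (ht.trans hγ), hline, fun t h1 h2 => ?_,
      ?_, fun j hj => ?_⟩, ?_, hξ, fun a ha => hs a 0 ha fun _ => h0⟩
    · split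
      exacts [hwα j, h0]
    · simp [hw, hc]
    · refine hne t (hs₁.trans ?_) h2
      simpa [hw] using h1
    · simp [hw]
    · simp [hw, add_comm 3 j, hj]
    · simp [hw]
  by_cases hfreq : ∃ j, ∀ x < α, ∃ t, x ≤ t ∧ t < α ∧ (comp P c t).reg j < (comp P c α).reg j
  · obtain ⟨j, hj⟩ := hfreq
    obtain ⟨v, ξ, s, hv, -, hξ, hs⟩ := main s₀ le_rfl hs₀
    exact hv.isWITRMSingular_of_frequently_lt hξ hs hj
  · push Not at hfreq
    choose S hS hS' using hfreq
    -- No case distinction is needed for lines: a natural number that exceeds `k - 1` is at least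
    -- `k`.
    have hlineS : ∃ x < α, ∀ t, x ≤ t → t < α → (comp P c α).line ≤ (comp P c t).line := by
      rcases Nat.eq_zero_or_pos (comp P c α).line with h1 | h1
      · exact ⟨0, h0, fun t _ _ => h1 ▸ Nat.zero_le _⟩
      · obtain ⟨x, hx, h2⟩ := hL.1.1 ((comp P c α).line - 1) (by omega)
        exact ⟨x, hx, fun t h3 h4 => Nat.le_of_pred_lt (h2 t h3 h4)⟩
    obtain ⟨x, hx, hx'⟩ := hlineS
    -- Only finitely many registers matter, so one bound below `α` serves them all.
    have hsup : ∀ k : ℕ, ∃ y < α, ∀ j < k, S j ≤ y := by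
      intro k
      induction k with
      | zero => exact ⟨0, h0, fun j hj => absurd hj (Nat.not_lt_zero j)⟩
      | succ k ih =>
        obtain ⟨y, h1, h2⟩ := ih
        refine ⟨max y (S k), max_lt h1 (hS k), fun j hj => ?_⟩
        rcases Nat.lt_succ_iff_lt_or_eq.1 hj with hj | rfl
        exacts [(h2 j hj).trans (le_max_left _ _), le_max_right _ _]
    obtain ⟨y, hy, hy'⟩ := hsup n
    obtain ⟨v, ξ, s, hv, hv1, hξ, hs⟩ := main (max s₀ (max x y)) (le_max_left _ _)
      (max_lt hs₀ (max_lt hx hy))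
    refine hv.isWITRMSingular_of_eventually_le hξ hs (fun j hj t h1 h2 => ?_) fun t h1 h2 => ?_
    · rw [hv1] at h1
      exact hS' j t ((hy' j hj).trans (((le_max_right _ _).trans (le_max_right _ _)).trans h1)) h2
    · rw [hv1] at h1
      exact hx' t (((le_max_left _ _).trans (le_max_right _ _)).trans h1) h2

theorem mainTheorem9 (α : Ordinal.{u}) (hω : Ordinal.omega0 < α) (hα : IsAdmissibleOrdinal α) :
    IsUWeak α ↔ IsWITRMRegular α :=
  ⟨fun h => h.isWITRMRegular hω, fun h => h.isUWeak hω⟩
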